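/- Let $X$ be a complex Banach space and let $\mathbf T=(T_t)_{t\ge 0}$ be a strongly continuous semigroup on $X$ with generator $A$, growth bound $\omega_0\in[-\infty,\infty)$, resolvent set $\rho(A)$ and resolvent $R(\lambda)=(\lambda-A)^{-1}$. Let $1\le p<\infty$ and $\alpha\ge 0$. Fix $\omega>\max\{\omega_0+3,3\}$ and $0<\theta<\pi/6$. For $\alpha>0$ put $$A_\omega^{-\alpha}=\frac1{2\pi i}\int_\gamma \mu^{-\alpha}R(\mu+\omega)\,d\mu ,$$ where $\gamma$ runs upwards along the two rays $\{-1+te^{\pm i\theta}:t\ge 0\}$ (from $\infty e^{-i\theta}$ through $-1$ to $\infty e^{i\theta}$) and $\mu^{-\alpha}$ is taken with $\arg\mu\in(0,2\pi)$; put $A_\omega^{0}=I$. The operator $A_\omega^{-\alpha}$ is bounded and injective; let $A_\omega^{\alpha}=(A-\omega)^\alpha$ be its inverse, and let $X_\alpha$ be the domain of $A_\omega^\alpha$ (the range of $A_\omega^{-\alpha}$) with the norm $\|x\|_\alpha=\|A_\omega^\alpha x\|$. For functions on $\mathbb R$ write $\hat f(t)=\int_{\mathbb R} f(s)e^{-ist}\,ds$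 and $\check f(t)=\frac1{2\pi}\int_{\mathbb R} f(s)e^{ist}\,ds$. A function $m\in L_\infty(\mathbb R;\mathcal L(X_\alpha,X))$ is called a multiplier from $L_p(\mathbb R,X_\alpha)$ to $L_p(\mathbb R,X)$ if the operator $f\mapsto[m(\cdot)\hat f]^{\vee}$, defined on the $X_\alpha$-valued Schwartz functions, is bounded from the norm of $L_p(\mathbb R,X_\alpha)$ to the norm of $L_p(\mathbb R,X)$. Theorem. Suppose $i\mathbb R\subset\rho(A)$. Then the following assertions are equivalent: 1) the function $s\mapsto R(is)|_{X_\alpha}$ is a multiplier from $L_p(\mathbb R,X_\alpha)$ to $L_p(\mathbb R,X)$ (in particular it belongs to $L_\infty(\mathbb R;\mathcal L(X_\alpha,X))$); 2) for every $g\in L_p(\mathbb R,X_\alpha)$ there is a unique function $u:\mathbb R\to X$ belonging to $L_p(\mathbb R,X)$ that satisfies $$u(\vartheta)=T_{\vartheta-\tau}u(\tau)+\int_\tau^\vartheta T_{\vartheta-s}g(s)\,ds\qquad\text{for all real }\vartheta\ge\tau .$$ -/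

import Mathlib

open MeasureTheory Set Filter Topology
open scoped ENNReal NNReal SchwartzMap

noncomputable section

/-- A strongly continuous semigroup of bounded operators on `X`. Only the values `T t` with `t ≥ 0`
are meaningful (and used). -/
structure C0Semigroup (X : Type*) [NormedAddCommGroup X] [NormedSpace ℂ X] where
  /-- the operators `T t`, `t ≥ 0` -/
  op : ℝ → X →L[ℂ] X
  op_zero : op 0 = ContinuousLinearMap.id ℂ X
  op_add : ∀ s t : ℝ, 0 ≤ s → 0 ≤ t → op (s + t) = (op s).comp (op t)
  continuousOn : ∀ x : X, ContinuousOn (fun t => op t x) (Ici 0)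

section Semigroup

variable {X : Type*} [NormedAddCommGroup X] [NormedSpace ℂ X]

/-- `y = lim_{t → 0+} (T t x - x) / t`. -/
def C0Semigroup.HasGenerator (T : C0Semigroup X) (x y : X) : Prop :=
  Tendsto (fun t : ℝ => ((t⁻¹ : ℝ) : ℂ) • (T.op t x - x)) (𝓝[>] 0) (𝓝 y)

theorem C0Semigroup.HasGenerator.add {T : C0Semigroup X} {x y x' y' : X}
    (h : T.HasGenerator x y) (h' : T.HasGenerator x' y') :
    T.HasGenerator (x + x') (y + y') := by
  refine (Tendsto.add h h').congr fun t => ?_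
  rw [map_add, ← smul_add]
  congr 1
  abel

theorem C0Semigroup.HasGenerator.smul {T : C0Semigroup X} {x y : X} (c : ℂ)
    (h : T.HasGenerator x y) : T.HasGenerator (c • x) (c • y) := by
  refine (Tendsto.const_smul h c).congr fun t => ?_
  rw [map_smul, ← smul_sub, smul_comm]

/-- The (infinitesimal) generator `A` of the semigroup, as an unbounded operator: its domain
consists of the `x` for which the limit `lim_{t → 0+} (T t x - x) / t` exists, and `A x` is this
limit. -/
def C0Semigroup.generator (T : C0Semigroup X) : X →ₗ.[ℂ] X where
  domain :=
    { carrier := {x | ∃ y, T.HasGenerator x y}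
      add_mem' := fun ⟨y, hy⟩ ⟨y', hy'⟩ => ⟨y + y', hy.add hy'⟩
      zero_mem' := ⟨0, by simp [C0Semigroup.HasGenerator]⟩
      smul_mem' := fun c _ ⟨y, hy⟩ => ⟨c • y, hy.smul c⟩ }
  toFun :=
    { toFun := fun x => x.2.choose
      map_add' := fun x x' =>
        tendsto_nhds_unique (x + x').2.choose_spec (x.2.choose_spec.add x'.2.choose_spec)
      map_smul' := fun c x =>
        tendsto_nhds_unique (c • x).2.choose_spec (x.2.choose_spec.smul c) }

/-- The growth bound `ω₀(T) = inf {w | ∃ M, ∀ t ≥ 0, ‖T t‖ ≤ M e^{w t}}`, which may be `-∞`. -/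
def C0Semigroup.growthBound (T : C0Semigroup X) : EReal :=
  sInf {e : EReal | ∃ w : ℝ, e = (w : EReal) ∧
    ∃ M : ℝ, ∀ t : ℝ, 0 ≤ t → ‖T.op t‖ ≤ M * Real.exp (w * t)}

/-- The bounded operator `R` is the two-sided inverse of `z - A : D(A) → X`. -/
def IsResolventAt (A : X →ₗ.[ℂ] X) (z : ℂ) (R : X →L[ℂ] X) : Prop :=
  (∀ x : X, ∃ h : R x ∈ A.domain, z • R x - A ⟨R x, h⟩ = x) ∧
    ∀ x : A.domain, R (z • (x : X) - A x) = x

/-- The resolvent set `ρ(A)` of an unbounded operator. -/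
def unboundedResolventSet (A : X →ₗ.[ℂ] X) : Set ℂ :=
  {z | ∃ R : X →L[ℂ] X, IsResolventAt A z R}

open Classical in
/-- The resolvent `R(z, A) = (z - A)⁻¹`, for `z ∈ ρ(A)` (and `0` for other `z`). -/
def unboundedResolvent (A : X →ₗ.[ℂ] X) (z : ℂ) : X →L[ℂ] X :=
  if h : ∃ R : X →L[ℂ] X, IsResolventAt A z R then h.choose else 0

/-- The power `μ^{-α}`, holomorphic off the cut `[0, ∞)`: the argument of `μ` is taken in
`(0, 2π)`. (`log (-μ) + π i` is the logarithm of `μ` with this argument.) -/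
def negCpow (α : ℝ) (μ : ℂ) : ℂ :=
  Complex.exp (-(α : ℂ) * (Complex.log (-μ) + (Real.pi : ℂ) * Complex.I))

/-- The integral `∫_γ F(μ) dμ` over the path `γ` that runs upwards along the two rays
`{-1 + t e^{-iθ} : t ≥ 0}` (from infinity to `-1`) and `{-1 + t e^{iθ} : t ≥ 0}`
(from `-1` to infinity). -/
def wedgeIntegral {E : Type*} [NormedAddCommGroup E] [NormedSpace ℂ E] (θ : ℝ) (F : ℂ → E) : E :=
  (∫ t in Ioi (0 : ℝ), Complex.exp ((θ : ℂ) * Complex.I) •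
      F (-1 + (t : ℂ) * Complex.exp ((θ : ℂ) * Complex.I))) -
    ∫ t in Ioi (0 : ℝ), Complex.exp (-((θ : ℂ) * Complex.I)) •
      F (-1 + (t : ℂ) * Complex.exp (-((θ : ℂ) * Complex.I)))

open Classical in
/-- The bounded operator `(A - ω)^{-α} = (2πi)⁻¹ ∫_γ μ^{-α} R(μ + ω, A) dμ` for `α > 0` (an
absolutely convergent integral in operator norm, when `ω > ω₀ + 3`, `0 < θ < π/6`), and the identity
for `α = 0`. -/
def C0Semigroup.fracPowNeg (T : C0Semigroup X) (ω θ α : ℝ) : X →L[ℂ] X :=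
  if α = 0 then ContinuousLinearMap.id ℂ X
  else (2 * (Real.pi : ℂ) * Complex.I)⁻¹ •
    wedgeIntegral θ fun μ => negCpow α μ • unboundedResolvent T.generator (μ + (ω : ℂ))

/-! ### The range of a bounded operator as a Banach space -/

/-- The range of a bounded operator `J`, normed by `‖x‖ = inf {‖y‖ : J y = x}`; for an injective
`J` this is `‖x‖ = ‖J⁻¹ x‖`. -/
def OpRange (J : X →L[ℂ] X) : Type _ := LinearMap.range (J : X →ₗ[ℂ] X)

namespace OpRange

variable (J : X →L[ℂ] X)

instance : AddCommGroup (OpRange J) :=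
  inferInstanceAs (AddCommGroup (LinearMap.range (J : X →ₗ[ℂ] X)))

instance : Module ℂ (OpRange J) :=
  inferInstanceAs (Module ℂ (LinearMap.range (J : X →ₗ[ℂ] X)))

instance : IsClosed ((LinearMap.ker (J : X →ₗ[ℂ] X) : Submodule ℂ X) : Set X) :=
  J.isClosed_ker

/-- The range of `J` as the quotient of `X` by the kernel of `J`, through which it is normed. -/
def toQuot : OpRange J ≃ₗ[ℂ] (X ⧸ LinearMap.ker (J : X →ₗ[ℂ] X)) :=
  (J : X →ₗ[ℂ] X).quotKerEquivRange.symm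

instance : NormedAddCommGroup (OpRange J) :=
  NormedAddCommGroup.induced (OpRange J) (X ⧸ LinearMap.ker (J : X →ₗ[ℂ] X)) (toQuot J)
    (toQuot J).injective

instance : NormedSpace ℂ (OpRange J) :=
  NormedSpace.induced ℂ (OpRange J) (X ⧸ LinearMap.ker (J : X →ₗ[ℂ] X)) (toQuot J)

/-- `toQuot` as a linear isometric equivalence. -/
def toQuotIsometry : OpRange J ≃ₗᵢ[ℂ] (X ⧸ LinearMap.ker (J : X →ₗ[ℂ] X)) where
  toLinearEquiv := toQuot J
  norm_map' := fun _ => rfl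

instance [CompleteSpace X] : CompleteSpace (OpRange J) :=
  (toQuotIsometry J).toIsometryEquiv.completeSpace

/-- The element `J y` of the range of `J`. -/
def mk (y : X) : OpRange J := ⟨J y, y, rfl⟩

/-- The inclusion of the range of `J` into `X`, as a linear map. -/
def inclₗ : OpRange J →ₗ[ℂ] X := (LinearMap.range (J : X →ₗ[ℂ] X)).subtype

theorem toQuot_mk (y : X) : toQuot J (mk J y) = Submodule.Quotient.mk y :=
  (J : X →ₗ[ℂ] X).quotKerEquivRange.symm_apply_eq.2 rfl

theorem norm_mk_le (y : X) : ‖mk J y‖ ≤ ‖y‖ := by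
  change ‖toQuot J (mk J y)‖ ≤ ‖y‖
  rw [toQuot_mk]
  exact Submodule.Quotient.norm_mk_le _ y

theorem exists_norm_lt (x : OpRange J) {ε : ℝ} (hε : 0 < ε) :
    ∃ y : X, J y = inclₗ J x ∧ ‖y‖ < ‖x‖ + ε := by
  obtain ⟨y, hy, hlt⟩ := Submodule.Quotient.norm_mk_lt (toQuot J x) hε
  refine ⟨y, ?_, hlt⟩
  have : mk J y = x := (toQuot J).injective ((toQuot_mk J y).trans hy)
  rw [← this]
  rfl

/-- The norm of `OpRange J` is `‖x‖ = inf {‖y‖ : J y = x}`. -/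
theorem norm_isGLB (x : OpRange J) : IsGLB {r : ℝ | ∃ y : X, J y = inclₗ J x ∧ r = ‖y‖} ‖x‖ := by
  constructor
  · rintro r ⟨y, hy, rfl⟩
    have : mk J y = x := Subtype.ext hy
    rw [← this]
    exact norm_mk_le J y
  · intro b hb
    refine le_of_forall_pos_le_add fun ε hε => ?_
    obtain ⟨y, hy, hlt⟩ := exists_norm_lt J x hε
    exact (hb ⟨y, hy, rfl⟩).trans hlt.le

/-- For an injective `J`, the norm of `OpRange J` is `‖x‖ = ‖J⁻¹ x‖`. -/
theorem norm_mk_of_injective (hJ : Function.Injective J) (y : X) : ‖mk J y‖ = ‖y‖ := by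
  refine le_antisymm (norm_mk_le J y) ((norm_isGLB J (mk J y)).2 ?_)
  rintro r ⟨z, hz, rfl⟩
  have : z = y := hJ hz
  rw [this]

/-- The continuous inclusion of the range of `J` into `X`. -/
def incl : OpRange J →L[ℂ] X :=
  (inclₗ J).mkContinuous ‖J‖ fun x => by
    refine le_of_forall_pos_le_add fun ε hε => ?_
    have hp : 0 < ‖J‖ + 1 := by positivity
    obtain ⟨y, hy, hlt⟩ := exists_norm_lt J x (div_pos hε hp)
    rw [← hy]
    calc ‖J y‖ ≤ ‖J‖ * ‖y‖ := J.le_opNorm y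
      _ ≤ ‖J‖ * (‖x‖ + ε / (‖J‖ + 1)) := by gcongr
      _ = ‖J‖ * ‖x‖ + ‖J‖ / (‖J‖ + 1) * ε := by ring
      _ ≤ ‖J‖ * ‖x‖ + 1 * ε := by
          gcongr
          rw [div_le_one hp]
          linarith
      _ = ‖J‖ * ‖x‖ + ε := by rw [one_mul]

end OpRange

/-- The Banach space `X_α`: the domain of `(A - ω)^α`, i.e. the range of its bounded inverse
`(A - ω)^{-α}`, with the norm `‖x‖_α = ‖(A - ω)^α x‖`. -/
abbrev C0Semigroup.FracDomain (T : C0Semigroup X) (ω θ α : ℝ) : Type _ :=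
  OpRange (T.fracPowNeg ω θ α)

/-- The inclusion `X_α → X`. -/
abbrev C0Semigroup.fracIncl (T : C0Semigroup X) (ω θ α : ℝ) : T.FracDomain ω θ α →L[ℂ] X :=
  OpRange.incl (T.fracPowNeg ω θ α)

/-- `u : ℝ → X` is a mild solution on the whole line of `u' = A u + g`:
`u(θ) = T_{θ-τ} u(τ) + ∫_τ^θ T_{θ-s} g(s) ds` for all `τ ≤ θ`. -/
def C0Semigroup.IsMildSolution (T : C0Semigroup X) (g u : ℝ → X) : Prop :=
  ∀ τ θ : ℝ, τ ≤ θ → u θ = T.op (θ - τ) (u τ) + ∫ s in τ..θ, T.op (θ - s) (g s)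

end Semigroup

section Multiplier

variable {E F : Type*} [NormedAddCommGroup E] [NormedSpace ℂ E]
  [NormedAddCommGroup F] [NormedSpace ℂ F]

/-- The Fourier transform `f^(t) = ∫ f(s) e^{-ist} ds`. -/
def fourierHat (f : ℝ → E) (t : ℝ) : E :=
  ∫ s : ℝ, Complex.exp (-(Complex.I * (s : ℂ) * (t : ℂ))) • f s

/-- The inverse Fourier transform `(2π)⁻¹ ∫ f(s) e^{ist} ds`. -/
def fourierCheck (f : ℝ → E) (t : ℝ) : E :=
  (2 * (Real.pi : ℂ))⁻¹ • ∫ s : ℝ, Complex.exp (Complex.I * (s : ℂ) * (t : ℂ)) • f s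

/-- The operator `M f = [m(·) f^]ˇ` with symbol `m`. -/
def multiplierOp (m : ℝ → E →L[ℂ] F) (f : ℝ → E) : ℝ → F :=
  fourierCheck fun s => m s (fourierHat f s)

/-- `m ∈ L_∞(ℝ, L(E, F))` is a Fourier multiplier from `L_p(ℝ, E)` to `L_p(ℝ, F)`: the operator
`M f = [m(·) f^]ˇ`, given on the Schwartz functions (which are dense in `L_p(ℝ, E)`, `p < ∞`),
is bounded from the norm of `L_p(ℝ, E)` to the norm of `L_p(ℝ, F)`. -/
def IsFourierMultiplier [CompleteSpace E] [CompleteSpace F] (p : ℝ≥0∞) (m : ℝ → E →L[ℂ] F) :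
    Prop :=
  MemLp m ∞ (volume : Measure ℝ) ∧
    ∃ C : ℝ≥0, ∀ f : 𝓢(ℝ, E), MemLp (multiplierOp m f) p (volume : Measure ℝ) ∧
      eLpNorm (multiplierOp m f) p (volume : Measure ℝ) ≤
        C * eLpNorm f p (volume : Measure ℝ)

end Multiplier

end

/-! ### Strongly continuous semigroups and the variation of constants formula -/

namespace C0Semigroup

variable {X : Type*} [NormedAddCommGroup X] [NormedSpace ℂ X]

/-! Everything rests on the mild solutions `e^{ist} R(is)x` with forcing `e^{ist} x`. Superposing
them with the Fourier transform of a Schwartz function `f` shows that `multiplierOp` applied to `f`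
is a mild solution with forcing `f` (`isMildSolution_multiplierOp`).

Uniqueness (`isMildSolution_unique`) holds among all `u` with `‖u(t)‖ / (1 + t²)` integrable, a
class containing both `L_p` and the bounded functions. A difference of two solutions is a complete
trajectory `w` of the semigroup. For a test function `ψ` let `k` and `K` be the Fourier integrals of
`ψ` and of `s ↦ ψ(s) R(is)`. Formally `K' = A K + k`, so `K(t) w(-t)` has derivative `k(t) w(-t)`;
both are integrable, hence `∫ k(t) w(-t) dt = 0`. As `ψ` varies this annihilates every frequency of
`w`, and `trajectory_eq_zero` follows.

From multiplier to solvability: Schwartz functions are dense, the multiplier bound makes the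
solutions Cauchy, and mild solutions survive `L_p` limits (`exists_isMildSolution_of_tendsto_Lp`).

From solvability to multiplier: the closed graph theorem yields an `L_p` estimate. Testing it on
slowly cut off periodic solutions bounds `R(is)` (`norm_resolvent_comp_le_of_eLpNorm_le`), and by
uniqueness `multiplierOp` produces exactly the `L_p` solution, so the estimate is the multiplier
bound.

The space `X_α` enters through its bounded inclusion in `X` and the invariance of its image under
the resolvent, so the analysis is done for a general bounded `ι : E →L[ℂ] X`. -/

theorem op_comm (T : C0Semigroup X) {s t : ℝ} (hs : 0 ≤ s) (ht : 0 ≤ t) (x : X) :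
    T.op s (T.op t x) = T.op t (T.op s x) := by
  rw [← ContinuousLinearMap.comp_apply, ← ContinuousLinearMap.comp_apply, ← T.op_add s t hs ht,
    ← T.op_add t s ht hs, add_comm]

theorem op_sub_op_sub (T : C0Semigroup X) {r s t : ℝ} (hrs : r ≤ s) (hst : s ≤ t) (x : X) :
    T.op (t - s) (T.op (s - r) x) = T.op (t - r) x := by
  rw [← ContinuousLinearMap.comp_apply, ← T.op_add _ _ (sub_nonneg.2 hst) (sub_nonneg.2 hrs),
    sub_add_sub_cancel]

/-- A strongly continuous semigroup is bounded on bounded time intervals. -/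
theorem exists_norm_op_le [CompleteSpace X] (T : C0Semigroup X) (a : ℝ) :
    ∃ M : ℝ, 0 ≤ M ∧ ∀ t : ℝ, 0 ≤ t → t ≤ a → ‖T.op t‖ ≤ M := by
  have key : ∀ x : X, ∃ C : ℝ, ∀ t : Icc (0 : ℝ) a, ‖T.op t x‖ ≤ C := by
    intro x
    obtain ⟨C, hC⟩ := isCompact_Icc.exists_bound_of_continuousOn
      ((T.continuousOn x).mono (Icc_subset_Ici_self : Icc (0 : ℝ) a ⊆ Ici 0))
    exact ⟨C, fun t => hC t t.2⟩
  obtain ⟨M, hM⟩ := banach_steinhaus key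
  exact ⟨max M 0, le_max_right _ _, fun t h0 ha => (hM ⟨t, h0, ha⟩).trans (le_max_left _ _)⟩

/-- Joint continuity of a strongly continuous semigroup, extended to negative times by `T 0`. -/
theorem continuous_op_max [CompleteSpace X] (T : C0Semigroup X) :
    Continuous fun q : ℝ × X => T.op (max q.1 0) q.2 := by
  refine continuous_iff_continuousAt.2 fun ⟨t₀, x₀⟩ => ?_
  obtain ⟨M, hM0, hM⟩ := T.exists_norm_op_le (max (t₀ + 1) 0)
  have hc : Continuous fun t : ℝ => T.op (max t 0) x₀ :=
    (T.continuousOn x₀).comp_continuous (continuous_id.max continuous_const)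
      fun t => le_max_right t 0
  have h1 : Tendsto (fun q : ℝ × X => T.op (max q.1 0) x₀) (𝓝 (t₀, x₀))
      (𝓝 (T.op (max t₀ 0) x₀)) := (hc.comp continuous_fst).tendsto (t₀, x₀)
  have h2 : Tendsto (fun q : ℝ × X => T.op (max q.1 0) (q.2 - x₀)) (𝓝 (t₀, x₀)) (𝓝 0) := by
    have h3 : Tendsto (fun q : ℝ × X => M * ‖q.2 - x₀‖) (𝓝 (t₀, x₀)) (𝓝 0) := by
      have : Continuous fun q : ℝ × X => M * ‖q.2 - x₀‖ := by fun_prop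
      simpa using this.tendsto (t₀, x₀)
    refine squeeze_zero_norm' ?_ h3
    have : ∀ᶠ q : ℝ × X in 𝓝 (t₀, x₀), q.1 < t₀ + 1 :=
      continuous_fst.continuousAt.eventually_lt continuousAt_const (by simp)
    filter_upwards [this] with q hq
    refine ((T.op _).le_opNorm _).trans ?_
    gcongr
    exact hM _ (le_max_right _ _) (max_le_max hq.le le_rfl)
  have := h2.add h1
  simp only [map_sub, sub_add_cancel, zero_add] at this
  exact this

theorem continuous_op_max_apply [CompleteSpace X] (T : C0Semigroup X) (x : X) :
    Continuous fun t : ℝ => T.op (max t 0) x :=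
  T.continuous_op_max.comp (continuous_id.prodMk continuous_const)

theorem intervalIntegrable_op [CompleteSpace X] (T : C0Semigroup X) {f : ℝ → X}
    (hf : LocallyIntegrable f) {a b t : ℝ} (hab : a ≤ b) (hb : b ≤ t) :
    IntervalIntegrable (fun s => T.op (t - s) (f s)) volume a b := by
  rw [intervalIntegrable_iff_integrableOn_Ioc_of_le hab]
  obtain ⟨M, -, hM⟩ := T.exists_norm_op_le (t - a)
  have hfi : IntegrableOn f (Ioc a b) := 
    (hf.integrableOn_isCompact isCompact_Icc).mono_set Ioc_subset_Icc_self
  -- Truncating time at `0` makes the integrand a jointly continuous function of `(t - s, f s)`; on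
  -- `Ioc a b` the truncation changes nothing.
  have hmeas : AEStronglyMeasurable (fun s => T.op (max (t - s) 0) (f s))
      (volume.restrict (Ioc a b)) := by
    refine T.continuous_op_max.comp_aestronglyMeasurable (f := fun s => (t - s, f s)) ?_
    exact (by fun_prop : Continuous fun s : ℝ => t - s).aestronglyMeasurable.prodMk
      hfi.aestronglyMeasurable
  have heq : (fun s => T.op (max (t - s) 0) (f s)) =ᵐ[volume.restrict (Ioc a b)]
      fun s => T.op (t - s) (f s) := by
    filter_upwards [ae_restrict_mem measurableSet_Ioc] with s hs
    rw [max_eq_left (by linarith [hs.2])]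
  refine (hfi.norm.const_mul M).mono' (hmeas.congr heq) ?_
  filter_upwards [ae_restrict_mem measurableSet_Ioc] with s hs
  refine ((T.op _).le_opNorm _).trans ?_
  gcongr
  exact hM _ (by linarith [hs.2]) (by linarith [hs.1])

theorem op_integral_op [CompleteSpace X] (T : C0Semigroup X) {f : ℝ → X}
    (hf : LocallyIntegrable f) {a b t : ℝ} (hab : a ≤ b) (hb : b ≤ t) :
    T.op (t - b) (∫ s in a..b, T.op (b - s) (f s)) = ∫ s in a..b, T.op (t - s) (f s) := by
  rw [← ContinuousLinearMap.intervalIntegral_comp_comm _ (T.intervalIntegrable_op hf hab le_rfl)]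
  refine intervalIntegral.integral_congr fun s hs => ?_
  rw [uIcc_of_le hab] at hs
  exact T.op_sub_op_sub hs.2 hb _

/-- The cocycle property of the solution operators of the inhomogeneous problem. -/
theorem op_add_integral_trans [CompleteSpace X] (T : C0Semigroup X) {f : ℝ → X}
    (hf : LocallyIntegrable f) {a b t : ℝ} (hab : a ≤ b) (hb : b ≤ t) (x : X) :
    T.op (t - b) (T.op (b - a) x + ∫ s in a..b, T.op (b - s) (f s)) +
        ∫ s in b..t, T.op (t - s) (f s) =
      T.op (t - a) x + ∫ s in a..t, T.op (t - s) (f s) := by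
  rw [map_add, T.op_sub_op_sub hab hb, T.op_integral_op hf hab hb, add_assoc,
    intervalIntegral.integral_add_adjacent_intervals (T.intervalIntegrable_op hf hab hb)
      (T.intervalIntegrable_op hf hb le_rfl)]

/-- A function satisfying the variation of constants formula for almost all times agrees almost
everywhere with a mild solution. -/
theorem exists_isMildSolution_of_ae [CompleteSpace X] (T : C0Semigroup X) {f u : ℝ → X}
    (hf : LocallyIntegrable f) {N : Set ℝ} (hN : ∀ᵐ t, t ∈ N)
    (h : ∀ a ∈ N, ∀ b ∈ N, a ≤ b → u b = T.op (b - a) (u a) + ∫ s in a..b, T.op (b - s) (f s)) :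
    ∃ v : ℝ → X, v =ᵐ[volume] u ∧ T.IsMildSolution f v := by
  -- A set of full measure meets every left half-line, so each time `t` has a good base point `σ t ≤
  -- t`.
  have hex : ∀ t : ℝ, ∃ a ∈ N, a ≤ t := by
    intro t
    have h1 : volume (Iic t) ≠ 0 := by simp
    have h2 := (frequently_ae_mem_iff.2 h1).and_eventually hN
    obtain ⟨a, ha, haN⟩ := h2.exists
    exact ⟨a, haN, ha⟩
  choose σ hσN hσ using hex
  let v : ℝ → X := fun t => T.op (t - σ t) (u (σ t)) + ∫ s in σ t..t, T.op (t - s) (f s)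
  -- By the cocycle property the value propagated to `t` does not depend on the base point.
  have hv : ∀ t, ∀ a ∈ N, a ≤ t →
      v t = T.op (t - a) (u a) + ∫ s in a..t, T.op (t - s) (f s) := by
    intro t a ha hat
    rcases le_total a (σ t) with hle | hle
    · rw [← T.op_add_integral_trans hf hle (hσ t), ← h a ha _ (hσN t) hle]
    · rw [h _ (hσN t) a ha hle, T.op_add_integral_trans hf hle hat]
  refine ⟨v, ?_, ?_⟩
  · filter_upwards [hN] with t ht
    rw [hv t t ht le_rfl, ← h t ht t ht le_rfl]
  · intro a b hab
    rw [hv b (σ a) (hσN a) ((hσ a).trans hab), ← T.op_add_integral_trans hf (hσ a) hab,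
      ← hv a (σ a) (hσN a) (hσ a)]

/-! ### Linear operations on mild solutions. -/

theorem IsMildSolution.sub [CompleteSpace X] {T : C0Semigroup X} {f g u v : ℝ → X}
    (hf : LocallyIntegrable f) (hg : LocallyIntegrable g) (hu : T.IsMildSolution f u)
    (hv : T.IsMildSolution g v) :
    T.IsMildSolution (fun s => f s - g s) (fun s => u s - v s) := by
  intro a b hab
  simp only [map_sub]
  rw [intervalIntegral.integral_sub (T.intervalIntegrable_op hf hab le_rfl)
    (T.intervalIntegrable_op hg hab le_rfl), hu a b hab, hv a b hab]
  abel

theorem IsMildSolution.add [CompleteSpace X] {T : C0Semigroup X} {f g u v : ℝ → X}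
    (hf : LocallyIntegrable f) (hg : LocallyIntegrable g) (hu : T.IsMildSolution f u)
    (hv : T.IsMildSolution g v) :
    T.IsMildSolution (fun s => f s + g s) (fun s => u s + v s) := by
  intro a b hab
  simp only [map_add]
  rw [intervalIntegral.integral_add (T.intervalIntegrable_op hf hab le_rfl)
    (T.intervalIntegrable_op hg hab le_rfl), hu a b hab, hv a b hab]
  abel

theorem IsMildSolution.const_smul {T : C0Semigroup X} {f u : ℝ → X} (c : ℂ)
    (hu : T.IsMildSolution f u) :
    T.IsMildSolution (fun s => c • f s) (fun s => c • u s) := by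
  intro a b hab
  simp only [map_smul]
  rw [intervalIntegral.integral_smul, hu a b hab, smul_add]

theorem IsMildSolution.congr_ae {T : C0Semigroup X} {f g u : ℝ → X}
    (hfg : f =ᵐ[volume] g) (hu : T.IsMildSolution f u) : T.IsMildSolution g u := by
  intro a b hab
  rw [hu a b hab]
  congr 1
  refine intervalIntegral.integral_congr_ae ?_
  filter_upwards [hfg] with s hs _
  rw [hs]

theorem IsMildSolution.sub_of_same [CompleteSpace X] {T : C0Semigroup X} {f u v : ℝ → X}
    (hf : LocallyIntegrable f) (hu : T.IsMildSolution f u) (hv : T.IsMildSolution f v)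
    {a b : ℝ} (hab : a ≤ b) : u b - v b = T.op (b - a) (u a - v a) := by
  simpa using hu.sub hf hf hv a b hab

/-- A complete trajectory of the semigroup is continuous. -/
theorem continuous_of_trajectory [CompleteSpace X] (T : C0Semigroup X) {w : ℝ → X}
    (hw : ∀ a b : ℝ, a ≤ b → w b = T.op (b - a) (w a)) : Continuous w := by
  refine continuous_iff_continuousAt.2 fun t => ?_
  have hc : Continuous fun s => T.op (max (s - (t - 1)) 0) (w (t - 1)) :=
    (T.continuous_op_max_apply (w (t - 1))).comp (continuous_id.sub continuous_const)
  refine hc.continuousAt.congr ?_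
  filter_upwards [Ioi_mem_nhds (show t - 1 < t by linarith)] with s hs
  rw [max_eq_left (by linarith [mem_Ioi.1 hs]), ← hw _ _ (le_of_lt hs)]

/-! ### The generator and its resolvent -/

theorem hasGenerator_generator (T : C0Semigroup X) (y : T.generator.domain) :
    T.HasGenerator y (T.generator y) :=
  y.2.choose_spec

theorem HasGenerator.op {T : C0Semigroup X} {y z : X} (h : T.HasGenerator y z) {t : ℝ}
    (ht : 0 ≤ t) : T.HasGenerator (T.op t y) (T.op t z) := by
  refine (((T.op t).continuous.tendsto z).comp h).congr' ?_
  filter_upwards [self_mem_nhdsWithin] with h hh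
  simp only [Function.comp_apply, map_smul, map_sub]
  rw [T.op_comm ht (le_of_lt hh)]

theorem HasGenerator.mem_domain {T : C0Semigroup X} {y z : X} (h : T.HasGenerator y z) :
    y ∈ T.generator.domain := ⟨z, h⟩

theorem HasGenerator.generator_eq {T : C0Semigroup X} {y z : X} (h : T.HasGenerator y z) :
    T.generator ⟨y, h.mem_domain⟩ = z :=
  tendsto_nhds_unique (T.hasGenerator_generator ⟨y, h.mem_domain⟩) h

/-- Orbits of elements of the domain of the generator are right differentiable. -/
theorem HasGenerator.hasDerivWithinAt_op {T : C0Semigroup X} {y z : X} (h : T.HasGenerator y z)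
    {t : ℝ} (ht : 0 ≤ t) : HasDerivWithinAt (fun s => T.op s y) (T.op t z) (Ioi t) t := by
  rw [hasDerivWithinAt_iff_tendsto_slope' (by simp)]
  have h1 : Tendsto (fun s : ℝ => s - t) (𝓝[>] t) (𝓝[>] 0) := by
    refine tendsto_nhdsWithin_iff.2 ⟨?_, ?_⟩
    · have : Continuous fun s : ℝ => s - t := by fun_prop
      simpa using (this.tendsto t).mono_left nhdsWithin_le_nhds
    · filter_upwards [self_mem_nhdsWithin] with s hs
      exact sub_pos.2 (mem_Ioi.1 hs)
  refine ((h.op ht).comp h1).congr' ?_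
  filter_upwards [self_mem_nhdsWithin] with s hs
  have hs' : t < s := hs
  simp only [Function.comp_apply, slope, vsub_eq_sub, Complex.coe_smul]
  rw [← ContinuousLinearMap.comp_apply, ← T.op_add _ _ (by linarith) ht, sub_add_cancel]

/-- The basic mild solutions `c(·) y` with `y` in the domain of the generator. -/
theorem HasGenerator.isMildSolution_smul [CompleteSpace X] {T : C0Semigroup X} {y z : X}
    (h : T.HasGenerator y z) {c c' : ℝ → ℂ} (hc : ∀ t, HasDerivAt c (c' t) t)
    (hc' : Continuous c') :
    T.IsMildSolution (fun t => c' t • y - c t • z) (fun t => c t • y) := by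
  intro a b hab
  have hcc : Continuous c := continuous_iff_continuousAt.2 fun t => (hc t).continuousAt
  -- The orbit of `y` is only known to be right differentiable, so the fundamental theorem of
  -- calculus is applied, for fixed `b`, to the right derivative of `t ↦ c (b - t) • T.op t y`.
  have key : ∫ t in (0 : ℝ)..(b - a), (c (b - t) • T.op (max t 0) z -
      c' (b - t) • T.op (max t 0) y) =
      c (b - (b - a)) • T.op (b - a) y - c (b - 0) • T.op 0 y := by
    have hi : Continuous fun t => c (b - t) • T.op (max t 0) z - c' (b - t) • T.op (max t 0) y :=
      ((hcc.comp (continuous_const.sub continuous_id)).smul (T.continuous_op_max_apply z)).sub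
        ((hc'.comp (continuous_const.sub continuous_id)).smul (T.continuous_op_max_apply y))
    refine intervalIntegral.integral_eq_sub_of_hasDeriv_right_of_le (sub_nonneg.2 hab)
      (f := fun t => c (b - t) • T.op t y) ?_ ?_ (hi.intervalIntegrable _ _)
    · exact (hcc.comp (continuous_const.sub continuous_id)).continuousOn.smul
        ((T.continuousOn y).mono Icc_subset_Ici_self)
    · intro t ht
      have h1 : HasDerivAt (fun t => c (b - t)) (-c' (b - t)) t := by
        simpa using (hc (b - t)).comp_const_sub b t
      have h2 := h1.hasDerivWithinAt.smul (h.hasDerivWithinAt_op ht.1.le)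
      rw [max_eq_left ht.1.le]
      rw [neg_smul, ← sub_eq_add_neg] at h2
      exact h2
  have hsub : ∫ s in a..b, T.op (b - s) (c' s • y - c s • z) =
      -∫ t in (0 : ℝ)..(b - a), (c (b - t) • T.op (max t 0) z -
        c' (b - t) • T.op (max t 0) y) := by
    have := intervalIntegral.integral_comp_sub_left (a := a) (b := b)
      (fun t => T.op t (c' (b - t) • y - c (b - t) • z)) b
    simp only [sub_sub_cancel, sub_self] at this
    rw [this, ← intervalIntegral.integral_neg]
    refine intervalIntegral.integral_congr fun t ht => ?_
    rw [uIcc_of_le (sub_nonneg.2 hab)] at ht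
    simp only [map_sub, map_smul]
    rw [max_eq_left ht.1, neg_sub]
  change c b • y = T.op (b - a) (c a • y) + ∫ s in a..b, T.op (b - s) (c' s • y - c s • z)
  rw [hsub, key, T.op_zero, map_smul]
  simp

end C0Semigroup

/-! ### Algebra of the resolvent. -/

theorem isResolventAt_unboundedResolvent {X : Type*} [NormedAddCommGroup X] [NormedSpace ℂ X]
    {A : X →ₗ.[ℂ] X} {z : ℂ} (hz : z ∈ unboundedResolventSet A) :
    IsResolventAt A z (unboundedResolvent A z) := by
  have hz' : ∃ R : X →L[ℂ] X, IsResolventAt A z R := hz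
  rw [unboundedResolvent, dif_pos hz']
  exact hz'.choose_spec

theorem unboundedResolvent_of_notMem {X : Type*} [NormedAddCommGroup X] [NormedSpace ℂ X]
    {A : X →ₗ.[ℂ] X} {z : ℂ} (hz : z ∉ unboundedResolventSet A) :
    unboundedResolvent A z = 0 := by
  have hz' : ¬ ∃ R : X →L[ℂ] X, IsResolventAt A z R := hz
  rw [unboundedResolvent, dif_neg hz']

section Resolvent

variable {X : Type*} [NormedAddCommGroup X] [NormedSpace ℂ X] {A : X →ₗ.[ℂ] X}

/-- The resolvent identity. -/
theorem unboundedResolvent_sub_unboundedResolvent {z w : ℂ} (hz : z ∈ unboundedResolventSet A)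
    (hw : w ∈ unboundedResolventSet A) :
    unboundedResolvent A w - unboundedResolvent A z =
      (z - w) • (unboundedResolvent A z * unboundedResolvent A w) := by
  ext x
  obtain ⟨hy, hyx⟩ := (isResolventAt_unboundedResolvent hw).1 x
  have h1 := (isResolventAt_unboundedResolvent hz).2 ⟨_, hy⟩
  -- Here `(z - A) R(w)x` is rewritten through `(w - A) R(w)x = x`; applying `R(z)` then gives the
  -- identity.
  have h2 : z • unboundedResolvent A w x - A ⟨unboundedResolvent A w x, hy⟩ =
      x + (z - w) • unboundedResolvent A w x := by
    calc _ = (w • unboundedResolvent A w x - A ⟨unboundedResolvent A w x, hy⟩) +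
          (z - w) • unboundedResolvent A w x := by rw [sub_smul]; abel
      _ = _ := by rw [hyx]
  simp only [] at h1
  rw [h2, map_add, map_smul] at h1
  change unboundedResolvent A w x - unboundedResolvent A z x =
    (z - w) • unboundedResolvent A z (unboundedResolvent A w x)
  rw [sub_eq_iff_eq_add, add_comm]
  exact h1.symm

/-- Exchange the two points in the resolvent identity and cancel `z - w`. Off the resolvent set the
default value `0` commutes with everything, so contour integrals may be handled without locating the
contour. -/
theorem commute_unboundedResolvent (z w : ℂ) :
    Commute (unboundedResolvent A z) (unboundedResolvent A w) := by
  by_cases hz : z ∈ unboundedResolventSet A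
  swap
  · rw [unboundedResolvent_of_notMem hz]
    exact Commute.zero_left _
  by_cases hw : w ∈ unboundedResolventSet A
  swap
  · rw [unboundedResolvent_of_notMem hw]
    exact Commute.zero_right _
  rcases eq_or_ne z w with rfl | hne
  · exact Commute.refl _
  have h1 := unboundedResolvent_sub_unboundedResolvent hz hw
  have h2 := unboundedResolvent_sub_unboundedResolvent hw hz
  have h3 : (z - w) • (unboundedResolvent A z * unboundedResolvent A w) =
      (z - w) • (unboundedResolvent A w * unboundedResolvent A z) := by
    rw [← h1, ← neg_sub w z, neg_smul, ← h2, neg_sub]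
  exact smul_right_injective _ (sub_ne_zero.2 hne) h3

end Resolvent

theorem C0Semigroup.hasGenerator_resolvent {X : Type*} [NormedAddCommGroup X] [NormedSpace ℂ X]
    (T : C0Semigroup X) {z : ℂ} (hz : z ∈ unboundedResolventSet T.generator) (x : X) :
    T.HasGenerator (unboundedResolvent T.generator z x)
      (z • unboundedResolvent T.generator z x - x) := by
  obtain ⟨hy, hyx⟩ := (isResolventAt_unboundedResolvent hz).1 x
  have := T.hasGenerator_generator ⟨_, hy⟩
  rwa [← sub_eq_iff_eq_add.2 (sub_eq_iff_eq_add'.1 hyx)] at this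

/-- The semigroup preserves the domain and commutes with `A`, so `(z - A) T_t R(z)x = T_t x`; apply
`R(z)`. -/
theorem C0Semigroup.op_resolvent {X : Type*} [NormedAddCommGroup X] [NormedSpace ℂ X]
    (T : C0Semigroup X) {z : ℂ} (hz : z ∈ unboundedResolventSet T.generator) {t : ℝ} (ht : 0 ≤ t)
    (x : X) :
    T.op t (unboundedResolvent T.generator z x) = unboundedResolvent T.generator z (T.op t x) := by
  have h := (T.hasGenerator_resolvent hz x).op ht
  have h1 := (isResolventAt_unboundedResolvent hz).2 ⟨_, h.mem_domain⟩
  rw [h.generator_eq] at h1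
  simp only [] at h1
  rw [← h1, map_sub (T.op t), map_smul (T.op t), sub_sub_cancel]

/-! ### The Fourier transform with angular frequencies -/

section Fourier

open scoped FourierTransform ContDiff

variable {E : Type*} [NormedAddCommGroup E] [NormedSpace ℂ E]

theorem norm_exp_I_mul_mul (s t : ℝ) : ‖Complex.exp (Complex.I * (s : ℂ) * (t : ℂ))‖ = 1 := by
  rw [mul_assoc, ← Complex.ofReal_mul, Complex.norm_exp_I_mul_ofReal]

theorem continuous_exp_I_mul_mul :
    Continuous fun q : ℝ × ℝ => Complex.exp (Complex.I * (q.1 : ℂ) * (q.2 : ℂ)) := by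
  fun_prop

/-- Dilation by `2π` passes between angular frequencies and the `e^{2πist}` convention of `𝓕⁻`. -/
theorem integral_exp_smul_eq_fourierInv (f : ℝ → E) (t : ℝ) :
    ∫ s : ℝ, Complex.exp (Complex.I * (s : ℂ) * (t : ℂ)) • f s =
      𝓕⁻ f (t / (2 * Real.pi)) := by
  rw [Real.fourierInv_eq']
  congr 1 with s
  congr 2
  have : (Real.pi : ℂ) ≠ 0 := by exact_mod_cast Real.pi_ne_zero
  simp only [RCLike.inner_apply, conj_trivial]
  push_cast
  field_simp

theorem fourierHat_eq_fourier (f : ℝ → E) (t : ℝ) :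
    fourierHat f t = 𝓕 f (t / (2 * Real.pi)) := by
  rw [fourierHat, Real.fourier_eq']
  congr 1 with s
  congr 2
  have : (Real.pi : ℂ) ≠ 0 := by exact_mod_cast Real.pi_ne_zero
  simp only [RCLike.inner_apply, conj_trivial]
  push_cast
  field_simp

theorem integrable_exp_smul {f : ℝ → E} (hf : Integrable f) (t : ℝ) :
    Integrable fun s : ℝ => Complex.exp (Complex.I * (s : ℂ) * (t : ℂ)) • f s := by
  refine hf.norm.mono' ?_ (ae_of_all _ fun s => ?_)
  · exact (continuous_exp_I_mul_mul.comp (continuous_id.prodMk continuous_const) :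
      Continuous fun s : ℝ => Complex.exp (Complex.I * (s : ℂ) * (t : ℂ))).aestronglyMeasurable.smul
        hf.aestronglyMeasurable
  · rw [norm_smul, norm_exp_I_mul_mul, one_mul]

theorem norm_integral_exp_smul_le (f : ℝ → E) (t : ℝ) :
    ‖∫ s : ℝ, Complex.exp (Complex.I * (s : ℂ) * (t : ℂ)) • f s‖ ≤ ∫ s, ‖f s‖ := by
  refine (norm_integral_le_integral_norm _).trans (le_of_eq ?_)
  simp_rw [norm_smul, norm_exp_I_mul_mul, one_mul]

theorem continuous_integral_exp_smul {f : ℝ → E} (hf : Integrable f) :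
    Continuous fun t : ℝ => ∫ s : ℝ, Complex.exp (Complex.I * (s : ℂ) * (t : ℂ)) • f s := by
  refine continuous_of_dominated (bound := fun s => ‖f s‖)
    (fun t => (integrable_exp_smul hf t).aestronglyMeasurable) (fun t => ae_of_all _ fun s => ?_)
    hf.norm (ae_of_all _ fun s => ?_)
  · rw [norm_smul, norm_exp_I_mul_mul, one_mul]
  · exact (continuous_exp_I_mul_mul.comp (continuous_const.prodMk continuous_id)).smul
      continuous_const

theorem integrable_fourierHat [CompleteSpace E] (f : 𝓢(ℝ, E)) : Integrable (fourierHat f) := by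
  have h1 : Integrable (𝓕 (f : ℝ → E)) := by
    rw [← SchwartzMap.fourier_coe]
    exact (𝓕 f).integrable
  have h2 := h1.comp_div (show (2 * Real.pi) ≠ 0 by positivity)
  exact h2.congr (ae_of_all _ fun t => (fourierHat_eq_fourier f t).symm)

/-- Fourier inversion on the Schwartz space. -/
theorem fourierCheck_fourierHat [CompleteSpace E] (f : 𝓢(ℝ, E)) (t : ℝ) :
    fourierCheck (fourierHat f) t = f t := by
  have h1 : Integrable (𝓕 (f : ℝ → E)) := by
    rw [← SchwartzMap.fourier_coe]
    exact (𝓕 f).integrable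
  have h2 : 𝓕⁻ (𝓕 (f : ℝ → E)) t = f t := by
    rw [f.continuous.fourierInv_fourier_eq f.integrable h1]
  have h3 := Measure.integral_comp_div
    (fun s : ℝ => Complex.exp ((↑(2 * Real.pi * inner ℝ s t) * Complex.I)) • 𝓕 (f : ℝ → E) s)
    (2 * Real.pi)
  rw [← Real.fourierInv_eq', h2, abs_of_pos (by positivity)] at h3
  rw [fourierCheck]
  have h4 : ∀ s : ℝ, Complex.exp (Complex.I * (s : ℂ) * (t : ℂ)) • fourierHat f s =
      Complex.exp ((↑(2 * Real.pi * inner ℝ (s / (2 * Real.pi)) t) * Complex.I)) •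
        𝓕 (f : ℝ → E) (s / (2 * Real.pi)) := by
    intro s
    rw [fourierHat_eq_fourier]
    congr 2
    simp only [RCLike.inner_apply, conj_trivial]
    push_cast
    field_simp
  simp_rw [h4]
  rw [h3, ← Complex.coe_smul, smul_smul]
  push_cast
  rw [inv_mul_cancel₀ (by simp), one_smul]

/-- The Fourier integral of a smooth compactly supported function decays like `t⁻²`. -/
theorem exists_norm_integral_exp_smul_le [CompleteSpace E] {f : ℝ → E} (hf : ContDiff ℝ ∞ f)
    (hf' : HasCompactSupport f) :
    ∃ C : ℝ, 0 ≤ C ∧ ∀ t : ℝ,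
      ‖∫ s : ℝ, Complex.exp (Complex.I * (s : ℂ) * (t : ℂ)) • f s‖ ≤ C / (1 + t ^ 2) := by
  let g : 𝓢(ℝ, E) := hf'.toSchwartzMap hf
  -- The Schwartz bounds of orders `0` and `2` add up to the weight `1 + t²`; the factor `(2π)²`
  -- undoes the dilation.
  obtain ⟨C₀, hC₀, h0⟩ := (𝓕⁻ g).decay 0 0
  obtain ⟨C₂, hC₂, h2⟩ := (𝓕⁻ g).decay 2 0
  refine ⟨C₀ + C₂ * (2 * Real.pi) ^ 2, by positivity, fun t => ?_⟩
  rw [integral_exp_smul_eq_fourierInv]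
  have hg : 𝓕⁻ f = (𝓕⁻ g : 𝓢(ℝ, E)) := (SchwartzMap.fourierInv_coe g).symm
  rw [hg, le_div_iff₀ (by positivity)]
  have e0 := h0 (t / (2 * Real.pi))
  have e2 := h2 (t / (2 * Real.pi))
  simp only [norm_iteratedFDeriv_zero, pow_zero, one_mul, Real.norm_eq_abs, sq_abs, div_pow] at e0 e2
  have : (0 : ℝ) < (2 * Real.pi) ^ 2 := by positivity
  rw [div_mul_eq_mul_div, div_le_iff₀ this] at e2
  linarith

end Fourier

/-! ### The resolvent on the imaginary axis -/

section ImaginaryAxis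

open scoped ContDiff

variable {X : Type*} [NormedAddCommGroup X] [NormedSpace ℂ X] [CompleteSpace X]

/-- The resolvent identity reads `R s * Q s = R s₀` with `Q` affine and `Q s₀ = 1`. Near `s₀` the
factor `Q s` is a unit, and inversion in a Banach algebra is smooth. -/
theorem contDiff_resolvent_I_mul {A : X →ₗ.[ℂ] X}
    (hA : ∀ s : ℝ, Complex.I * (s : ℂ) ∈ unboundedResolventSet A) :
    ContDiff ℝ ∞ fun s : ℝ => unboundedResolvent A (Complex.I * (s : ℂ)) := by
  refine contDiff_iff_contDiffAt.2 fun s₀ => ?_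
  set R := fun s : ℝ => unboundedResolvent A (Complex.I * (s : ℂ)) with hR
  let Q : ℝ → X →L[ℂ] X := fun s => 1 + (Complex.I * (s : ℂ) - Complex.I * (s₀ : ℂ)) • R s₀
  have hid : ∀ s, R s * Q s = R s₀ := by
    intro s
    have := unboundedResolvent_sub_unboundedResolvent (hA s) (hA s₀)
    change R s₀ - R s = _ at this
    rw [mul_add, mul_one, mul_smul_comm, ← this]
    abel
  have hQ : ContDiff ℝ ∞ Q := by
    have h1 : ContDiff ℝ ∞ fun s : ℝ => (s : ℂ) := Complex.ofRealCLM.contDiff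
    exact contDiff_const.add (((contDiff_const.mul h1).sub contDiff_const).smul contDiff_const)
  have hQ0 : Q s₀ = ((1 : (X →L[ℂ] X)ˣ) : X →L[ℂ] X) := by simp [Q]
  have hinv : ContDiffAt ℝ ∞ (fun s => Ring.inverse (Q s)) s₀ := by
    have := contDiffAt_ringInverse ℝ (n := ∞) (1 : (X →L[ℂ] X)ˣ)
    rw [← hQ0] at this
    exact this.comp s₀ hQ.contDiffAt
  have hunit : ∀ᶠ s in 𝓝 s₀, IsUnit (Q s) := by
    have h1 : {x : X →L[ℂ] X | IsUnit x} ∈ 𝓝 (Q s₀) :=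
      Units.isOpen.mem_nhds (by rw [hQ0]; exact Units.isUnit _)
    exact hQ.continuous.continuousAt h1
  refine (contDiffAt_const.mul hinv : ContDiffAt ℝ ∞
    (fun s => R s₀ * Ring.inverse (Q s)) s₀).congr_of_eventuallyEq ?_
  filter_upwards [hunit] with s hs
  change R s = R s₀ * Ring.inverse (Q s)
  rw [← hid s, mul_assoc, Ring.mul_inverse_cancel _ hs, mul_one]

namespace C0Semigroup

variable (T : C0Semigroup X)

/-- The periodic mild solutions. -/
theorem isMildSolution_exp {s : ℝ} (hs : Complex.I * (s : ℂ) ∈ unboundedResolventSet T.generator)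
    (x : X) :
    T.IsMildSolution (fun t => Complex.exp (Complex.I * (s : ℂ) * (t : ℂ)) • x)
      (fun t => Complex.exp (Complex.I * (s : ℂ) * (t : ℂ)) •
        unboundedResolvent T.generator (Complex.I * (s : ℂ)) x) := by
  have hc : ∀ t : ℝ, HasDerivAt (fun t : ℝ => Complex.exp (Complex.I * (s : ℂ) * (t : ℂ)))
      (Complex.exp (Complex.I * (s : ℂ) * (t : ℂ)) * (Complex.I * (s : ℂ))) t := by
    intro t
    have h1 : HasDerivAt (fun t : ℝ => Complex.I * (s : ℂ) * (t : ℂ)) (Complex.I * (s : ℂ)) t := by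
      simpa using (Complex.ofRealCLM.hasDerivAt (x := t)).const_mul (Complex.I * (s : ℂ))
    exact h1.cexp
  -- With `y = R(is)x` and `A y = is y - x`, the forcing `c' y - c A y` collapses to `c x`.
  have := (T.hasGenerator_resolvent hs x).isMildSolution_smul hc (by fun_prop)
  convert this using 2 with t
  rw [smul_sub, smul_smul]
  abel

/-- Superposition of periodic mild solutions. -/
theorem isMildSolution_integral_exp
    (hA : ∀ s : ℝ, Complex.I * (s : ℂ) ∈ unboundedResolventSet T.generator) {h : ℝ → X}
    (hh : Integrable h)
    (hR : Integrable fun s : ℝ => unboundedResolvent T.generator (Complex.I * (s : ℂ)) (h s)) :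
    T.IsMildSolution (fun t => ∫ s : ℝ, Complex.exp (Complex.I * (s : ℂ) * (t : ℂ)) • h s)
      (fun t => ∫ s : ℝ, Complex.exp (Complex.I * (s : ℂ) * (t : ℂ)) •
        unboundedResolvent T.generator (Complex.I * (s : ℂ)) (h s)) := by
  intro a b hab
  have h1 := integrable_exp_smul hR a
  obtain ⟨M, hM0, hM⟩ := T.exists_norm_op_le (b - a)
  -- Domination by `M ‖h‖` on the product of a bounded interval and the line justifies Fubini; the
  -- identity then holds frequency by frequency.
  have hF : Integrable (fun q : ℝ × ℝ =>
      T.op (b - q.1) (Complex.exp (Complex.I * (q.2 : ℂ) * (q.1 : ℂ)) • h q.2))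
      ((volume.restrict (Ioc a b)).prod volume) := by
    have hmem : ∀ᵐ q : ℝ × ℝ ∂(volume.restrict (Ioc a b)).prod volume, q.1 ∈ Ioc a b :=
      Measure.quasiMeasurePreserving_fst.ae (ae_restrict_mem measurableSet_Ioc)
    have hdom : Integrable (fun q : ℝ × ℝ => M * ‖h q.2‖)
        ((volume.restrict (Ioc a b)).prod volume) :=
      (integrable_const M).mul_prod hh.norm
    refine hdom.mono' ?_ ?_
    · have h2 : AEStronglyMeasurable (fun q : ℝ × ℝ =>
          T.op (max (b - q.1) 0) (Complex.exp (Complex.I * (q.2 : ℂ) * (q.1 : ℂ)) • h q.2))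
          ((volume.restrict (Ioc a b)).prod volume) := by
        refine T.continuous_op_max.comp_aestronglyMeasurable
          (f := fun q : ℝ × ℝ => (b - q.1, Complex.exp (Complex.I * (q.2 : ℂ) * (q.1 : ℂ)) • h q.2)) ?_
        refine (by fun_prop : Continuous fun q : ℝ × ℝ => b - q.1).aestronglyMeasurable.prodMk ?_
        exact (by fun_prop : Continuous fun q : ℝ × ℝ =>
          Complex.exp (Complex.I * (q.2 : ℂ) * (q.1 : ℂ))).aestronglyMeasurable.smul
            hh.aestronglyMeasurable.comp_snd
      refine h2.congr ?_
      filter_upwards [hmem] with q hq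
      rw [max_eq_left (by linarith [hq.2])]
    · filter_upwards [hmem] with q hq
      refine ((T.op _).le_opNorm _).trans ?_
      rw [norm_smul, norm_exp_I_mul_mul, one_mul]
      gcongr
      exact hM _ (by linarith [hq.2]) (by linarith [hq.1])
  have hswap := integral_integral_swap (f := fun r s : ℝ =>
    T.op (b - r) (Complex.exp (Complex.I * (s : ℂ) * (r : ℂ)) • h s)) hF
  simp only [intervalIntegral.integral_of_le hab]
  have e1 : ∀ r : ℝ, T.op (b - r) (∫ s : ℝ, Complex.exp (Complex.I * (s : ℂ) * (r : ℂ)) • h s) =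
      ∫ s : ℝ, T.op (b - r) (Complex.exp (Complex.I * (s : ℂ) * (r : ℂ)) • h s) := fun r =>
    (ContinuousLinearMap.integral_comp_comm _ (integrable_exp_smul hh r)).symm
  simp_rw [e1]
  rw [hswap, ← ContinuousLinearMap.integral_comp_comm _ h1, ← integral_add]
  · refine integral_congr_ae (ae_of_all _ fun s => ?_)
    have := T.isMildSolution_exp (hA s) (h s) a b hab
    rwa [intervalIntegral.integral_of_le hab] at this
  · exact (T.op (b - a)).integrable_comp h1
  · exact hF.integral_prod_right

/-- Trajectories of moderate growth pair to zero with band limited functions. -/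
theorem integral_band_limited_smul_trajectory
    (hA : ∀ s : ℝ, Complex.I * (s : ℂ) ∈ unboundedResolventSet T.generator) {w : ℝ → X}
    (hw : ∀ a b : ℝ, a ≤ b → w b = T.op (b - a) (w a))
    (hint : Integrable fun t => ‖w t‖ / (1 + t ^ 2)) {ψ : ℝ → ℂ} (hψ : ContDiff ℝ ∞ ψ)
    (hψ' : HasCompactSupport ψ) :
    (Integrable fun t : ℝ =>
      (∫ s : ℝ, Complex.exp (Complex.I * (s : ℂ) * (t : ℂ)) • ψ s) • w (-t)) ∧
    ∫ t : ℝ, (∫ s : ℝ, Complex.exp (Complex.I * (s : ℂ) * (t : ℂ)) • ψ s) • w (-t) = 0 := by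
  set R : ℝ → X →L[ℂ] X := fun s => unboundedResolvent T.generator (Complex.I * (s : ℂ)) with hRdef
  have hRs : ContDiff ℝ ∞ R := contDiff_resolvent_I_mul hA
  have hwc : Continuous fun t => w (-t) := (T.continuous_of_trajectory hw).comp continuous_neg
  have hint' : Integrable fun t => ‖w (-t)‖ / (1 + t ^ 2) := by
    simpa using hint.comp_neg
  have hψi : Integrable ψ := hψ.continuous.integrable_of_hasCompactSupport hψ'
  set k : ℝ → ℂ := fun t => ∫ s : ℝ, Complex.exp (Complex.I * (s : ℂ) * (t : ℂ)) • ψ s with hk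
  have hΦ : ContDiff ℝ ∞ fun s => ψ s • R s := hψ.smul hRs
  have hΦ' : HasCompactSupport fun s => ψ s • R s := hψ'.smul_right
  have hΦi : Integrable fun s => ψ s • R s := hΦ.continuous.integrable_of_hasCompactSupport hΦ'
  set K : ℝ → X →L[ℂ] X :=
    fun t => ∫ s : ℝ, Complex.exp (Complex.I * (s : ℂ) * (t : ℂ)) • (ψ s • R s) with hK
  have hKapp : ∀ (t : ℝ) (x : X), K t x =
      ∫ s : ℝ, Complex.exp (Complex.I * (s : ℂ) * (t : ℂ)) • R s (ψ s • x) := by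
    intro t x
    rw [hK]
    simp only []
    rw [ContinuousLinearMap.integral_apply (integrable_exp_smul hΦi t)]
    simp
  have hkapp : ∀ (t : ℝ) (x : X), k t • x =
      ∫ s : ℝ, Complex.exp (Complex.I * (s : ℂ) * (t : ℂ)) • (ψ s • x) := by
    intro t x
    rw [hk]
    simp only []
    rw [← integral_smul_const]
    simp [smul_smul]
  have hKmild : ∀ x : X, T.IsMildSolution (fun t => k t • x) (fun t => K t x) := by
    intro x
    simp_rw [hKapp, hkapp]
    refine T.isMildSolution_integral_exp hA (hψi.smul_const x) ?_
    have : Integrable fun s => (ψ s • R s) x := hΦi.apply_continuousLinearMap x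
    simpa using this
  -- Commuting with the semigroup lets the propagator act on the trajectory value inside `K`.
  have hTK : ∀ t h : ℝ, 0 ≤ h → ∀ x, T.op h (K t x) = K t (T.op h x) := by
    intro t h hh x
    rw [hKapp, hKapp, ← ContinuousLinearMap.integral_comp_comm]
    · refine integral_congr_ae (ae_of_all _ fun s => ?_)
      simp only [map_smul]
      rw [T.op_resolvent (hA s) hh]
    · have : Integrable fun s => (ψ s • R s) x := hΦi.apply_continuousLinearMap x
      refine integrable_exp_smul ?_ t
      simpa using this
  have hkc : Continuous k := continuous_integral_exp_smul hψi
  have hkw : Continuous fun t => k t • w (-t) := hkc.smul hwc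
  -- Running the trajectory backwards cancels the generator term of `K`, leaving `P' = k(t) w(-t)`.
  set P : ℝ → X := fun t => K t (w (-t)) with hP
  have hdiff : ∀ a b : ℝ, a ≤ b → P b = P a + ∫ r in a..b, k r • w (-r) := by
    intro a b hab
    have h1 := hKmild (w (-b)) a b hab
    rw [hTK _ _ (sub_nonneg.2 hab)] at h1
    have h2 : w (-a) = T.op (b - a) (w (-b)) := by
      rw [hw (-b) (-a) (by linarith)]
      congr 2
      ring
    rw [← h2] at h1
    refine h1.trans ?_
    congr 1
    refine intervalIntegral.integral_congr fun r hr => ?_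
    rw [uIcc_of_le hab] at hr
    simp only [map_smul]
    rw [hw (-b) (-r) (by linarith [hr.2])]
    congr 3
    ring
  have hPint : ∀ t : ℝ, P t = P 0 + ∫ r in (0 : ℝ)..t, k r • w (-r) := by
    intro t
    rcases le_total 0 t with ht | ht
    · exact hdiff 0 t ht
    · rw [hdiff t 0 ht, intervalIntegral.integral_symm 0 t]
      abel
  have hderiv : ∀ t, HasDerivAt P (k t • w (-t)) t := by
    intro t
    have h1 := (hkw.integral_hasStrictDerivAt 0 t).hasDerivAt.const_add (P 0)
    exact h1.congr_of_eventuallyEq (Eventually.of_forall hPint)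
  -- Both `K` and `k` decay like `t⁻²`, exactly what the weighted integrability of `w` needs; an
  -- integrable function with integrable derivative has derivative of integral zero.
  obtain ⟨C, hC0, hC⟩ := exists_norm_integral_exp_smul_le hΦ hΦ'
  obtain ⟨c, hc0, hc⟩ := exists_norm_integral_exp_smul_le hψ hψ'
  have hi1 : Integrable fun t => k t • w (-t) := by
    refine (hint'.const_mul c).mono' hkw.aestronglyMeasurable (ae_of_all _ fun t => ?_)
    rw [norm_smul]
    calc ‖k t‖ * ‖w (-t)‖ ≤ c / (1 + t ^ 2) * ‖w (-t)‖ := by gcongr; exact hc t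
      _ = c * (‖w (-t)‖ / (1 + t ^ 2)) := by ring
  have hi2 : Integrable P := by
    have hPc : Continuous P := continuous_iff_continuousAt.2 fun t => (hderiv t).continuousAt
    refine (hint'.const_mul C).mono' hPc.aestronglyMeasurable (ae_of_all _ fun t => ?_)
    calc ‖K t (w (-t))‖ ≤ ‖K t‖ * ‖w (-t)‖ := (K t).le_opNorm _
      _ ≤ C / (1 + t ^ 2) * ‖w (-t)‖ := by gcongr; exact hC t
      _ = C * (‖w (-t)‖ / (1 + t ^ 2)) := by ring
  exact ⟨hi1, integral_eq_zero_of_hasDerivAt_of_integrable hderiv hi1 hi2⟩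

open scoped FourierTransform in
/-- If the imaginary axis belongs to the resolvent set of the generator, then there are no nonzero
complete trajectories of moderate growth. -/
theorem trajectory_eq_zero
    (hA : ∀ s : ℝ, Complex.I * (s : ℂ) ∈ unboundedResolventSet T.generator) {w : ℝ → X}
    (hw : ∀ a b : ℝ, a ≤ b → w b = T.op (b - a) (w a))
    (hint : Integrable fun t => ‖w t‖ / (1 + t ^ 2)) (t₀ : ℝ) : w t₀ = 0 := by
  let β : ContDiffBump (0 : ℝ) := ⟨1, 2, one_pos, one_lt_two⟩
  let k : ℝ → ℂ := fun t => ∫ s : ℝ, Complex.exp (Complex.I * (s : ℂ) * (t : ℂ)) • (β s : ℂ)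
  have hβi : Integrable fun s => (β s : ℂ) :=
    (Complex.continuous_ofReal.comp β.continuous).integrable_of_hasCompactSupport
      (β.hasCompactSupport.comp_left Complex.ofReal_zero)
  have hβs : ContDiff ℝ ∞ fun s => (β s : ℂ) := Complex.ofRealCLM.contDiff.comp β.contDiff
  have hk0 : k 0 ≠ 0 := by
    simp only [k, Complex.ofReal_zero, mul_zero, Complex.exp_zero, one_smul]
    rw [integral_complex_ofReal]
    exact_mod_cast (β.integral_pos (μ := volume)).ne'
  let F : ℝ → X := fun t => k (t + t₀) • w (-t)
  have hFc : Continuous F :=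
    ((continuous_integral_exp_smul hβi).comp (continuous_add_const t₀)).smul
      ((T.continuous_of_trajectory hw).comp continuous_neg)
  -- Moving the bump to frequency `a` and modulating by `t₀` yields the kernel `e^{ia(t+t₀)}
  -- k(t+t₀)`, so the pairing becomes the Fourier integral of `F` at `a`, up to a unimodular factor.
  let ψ : ℝ → ℝ → ℂ := fun a s =>
    Complex.exp (Complex.I * (s : ℂ) * (t₀ : ℂ)) * (β (s - a) : ℂ)
  have hψ : ∀ a, ContDiff ℝ ∞ (ψ a) := by
    intro a
    have h1 : ContDiff ℝ ∞ fun s : ℝ => (s : ℂ) := Complex.ofRealCLM.contDiff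
    have h2 : ContDiff ℝ ∞ fun s : ℝ => s - a := contDiff_id.sub contDiff_const
    exact ((contDiff_const.mul h1).mul contDiff_const).cexp.mul (hβs.comp h2)
  have hψ' : ∀ a, HasCompactSupport (ψ a) := by
    intro a
    have h1 : HasCompactSupport fun s => (β (s - a) : ℂ) :=
      (β.hasCompactSupport.comp_left (g := fun x : ℝ => (x : ℂ))
        Complex.ofReal_zero).comp_homeomorph (Homeomorph.subRight a)
    exact h1.mul_left
  have hkψ : ∀ a t : ℝ, ∫ s : ℝ, Complex.exp (Complex.I * (s : ℂ) * (t : ℂ)) • ψ a s =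
      Complex.exp (Complex.I * (a : ℂ) * ((t + t₀ : ℝ) : ℂ)) • k (t + t₀) := by
    intro a t
    simp only [k]
    rw [← integral_sub_right_eq_self
      (fun s : ℝ => Complex.exp (Complex.I * (s : ℂ) * ((t + t₀ : ℝ) : ℂ)) • (β s : ℂ)) a,
      ← integral_smul]
    refine integral_congr_ae (ae_of_all _ fun s => ?_)
    simp only [ψ, smul_eq_mul, ← mul_assoc, ← Complex.exp_add]
    congr 2
    push_cast
    ring
  have hz : ∀ a : ℝ, Integrable F ∧
      ∫ t : ℝ, Complex.exp (Complex.I * (t : ℂ) * (a : ℂ)) • F t = 0 := by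
    intro a
    obtain ⟨h1, h2⟩ := T.integral_band_limited_smul_trajectory hA hw hint (hψ a) (hψ' a)
    have e1 : ∀ t : ℝ, (∫ s : ℝ, Complex.exp (Complex.I * (s : ℂ) * (t : ℂ)) • ψ a s) • w (-t) =
        Complex.exp (Complex.I * (a : ℂ) * (t₀ : ℂ)) •
          (Complex.exp (Complex.I * (t : ℂ) * (a : ℂ)) • F t) := by
      intro t
      rw [hkψ, smul_smul, ← Complex.exp_add, smul_assoc]
      congr 2
      push_cast
      ring
    simp_rw [e1] at h1 h2
    have hne : Complex.exp (Complex.I * (a : ℂ) * (t₀ : ℂ)) ≠ 0 := Complex.exp_ne_zero _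
    rw [integral_smul, smul_eq_zero_iff_right hne] at h2
    refine ⟨?_, h2⟩
    have h3 := (integrable_smul_iff hne _).1 h1
    refine h3.norm.mono' hFc.aestronglyMeasurable (ae_of_all _ fun t => ?_)
    rw [norm_smul (Complex.exp _), norm_exp_I_mul_mul, one_mul]
  have hFi := (hz 0).1
  have hinv : 𝓕⁻ F = 0 := by
    ext v
    have := (hz (2 * Real.pi * v)).2
    rw [integral_exp_smul_eq_fourierInv, mul_div_cancel_left₀ _ (by positivity)] at this
    exact this
  have h𝓕 : 𝓕 F = 0 := by
    ext v
    have := congrFun hinv (-v)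
    rw [Real.fourierInv_eq_fourier_neg, neg_neg] at this
    exact this
  have hF0 : F = 0 := by
    rw [← hFc.fourierInv_fourier_eq hFi (by rw [h𝓕]; exact integrable_zero _ _ _), h𝓕]
    ext v
    simp [Real.fourierInv_eq']
  -- At `-t₀` the function `F` equals `k(0) w(t₀)`, and `k(0)` is the positive integral of the bump.
  have := congrFun hF0 (-t₀)
  simp only [F, neg_add_cancel, neg_neg, Pi.zero_apply, smul_eq_zero] at this
  exact this.resolve_left hk0

end C0Semigroup

end ImaginaryAxis

/-! ### Mild solutions in `L_p` -/

section Weights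

theorem hasDerivAt_inv_one_add_mul_sq (ε t : ℝ) :
    HasDerivAt (fun t : ℝ => (1 + (ε * t) ^ 2)⁻¹)
      (-(2 * ε ^ 2 * t) / (1 + (ε * t) ^ 2) ^ 2) t := by
  have h1 : HasDerivAt (fun t : ℝ => 1 + (ε * t) ^ 2) (2 * ε ^ 2 * t) t := by
    have h2 := ((((hasDerivAt_id t).const_mul ε).pow 2).const_add 1)
    refine h2.congr_deriv ?_
    simp
    ring
  exact h1.inv (by positivity)

/-- This is `2|εt| ≤ 1 + (εt)²`. It makes the derivative of the cutoff small relative to the cutoff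
itself as `ε → 0`. -/
theorem abs_deriv_inv_one_add_mul_sq_le {ε : ℝ} (hε : 0 ≤ ε) (t : ℝ) :
    |-(2 * ε ^ 2 * t) / (1 + (ε * t) ^ 2) ^ 2| ≤ ε * (1 + (ε * t) ^ 2)⁻¹ := by
  have hpos : 0 < 1 + (ε * t) ^ 2 := by positivity
  rw [abs_div, abs_neg, abs_of_pos (pow_pos hpos 2), div_le_iff₀ (pow_pos hpos 2)]
  have h1 : ε * (1 + (ε * t) ^ 2)⁻¹ * (1 + (ε * t) ^ 2) ^ 2 = ε * (1 + (ε * t) ^ 2) := by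
    field_simp
  rw [h1, abs_le]
  constructor <;> nlinarith [mul_nonneg hε (sq_nonneg (ε * t - 1)),
    mul_nonneg hε (sq_nonneg (ε * t + 1))]

theorem memLp_inv_one_add_mul_sq {ε : ℝ} (hε : ε ≠ 0) {p : ℝ≥0∞} (hp : 1 ≤ p) (hp' : p ≠ ∞) :
    MemLp (fun t : ℝ => (1 + (ε * t) ^ 2)⁻¹) p := by
  have hp0 : p ≠ 0 := (zero_lt_one.trans_le hp).ne'
  have hc : Continuous fun t : ℝ => (1 + (ε * t) ^ 2)⁻¹ :=
    Continuous.inv₀ (by fun_prop) fun t => by positivity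
  have hi : Integrable fun t : ℝ => (1 + (ε * t) ^ 2)⁻¹ :=
    integrable_inv_one_add_sq.comp_mul_left' hε
  refine (integrable_norm_rpow_iff hc.aestronglyMeasurable hp0 hp').1 ?_
  have h1 : 1 ≤ p.toReal := by simpa using ENNReal.toReal_mono hp' hp
  refine hi.mono' (hc.norm.rpow_const fun t => Or.inr (by linarith)).aestronglyMeasurable
    (ae_of_all _ fun t => ?_)
  have hpos : 0 < (1 + (ε * t) ^ 2)⁻¹ := by positivity
  rw [Real.norm_of_nonneg (Real.rpow_nonneg (norm_nonneg _) _), Real.norm_of_nonneg hpos.le]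
  exact Real.rpow_le_self_of_le_one hpos.le
    (inv_le_one_of_one_le₀ (by nlinarith [sq_nonneg (ε * t)])) h1

variable {X : Type*} [NormedAddCommGroup X]

/-- Use `1` as a bound where `‖u‖ ≤ 1`, and `‖u‖ ≤ ‖u‖^p` elsewhere. Thus `L_p` solutions fall under
the uniqueness theorem. -/
theorem MeasureTheory.MemLp.integrable_norm_div_one_add_sq {p : ℝ≥0∞} {u : ℝ → X}
    (hu : MemLp u p) (hp : 1 ≤ p) (hp' : p ≠ ∞) : Integrable fun t => ‖u t‖ / (1 + t ^ 2) := by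
  have hp0 : p ≠ 0 := (zero_lt_one.trans_le hp).ne'
  have h1 : 1 ≤ p.toReal := by
    simpa using ENNReal.toReal_mono hp' hp
  have hmeas : AEStronglyMeasurable (fun t : ℝ => ‖u t‖ / (1 + t ^ 2)) volume := by
    simp_rw [div_eq_mul_inv]
    exact hu.1.norm.mul integrable_inv_one_add_sq.aestronglyMeasurable
  refine (integrable_inv_one_add_sq.add (hu.integrable_norm_rpow hp0 hp')).mono' hmeas
    (ae_of_all _ fun t => ?_)
  have h2 : 0 ≤ (1 + t ^ 2)⁻¹ := by positivity
  have h3 : (1 + t ^ 2)⁻¹ ≤ 1 := inv_le_one_of_one_le₀ (by nlinarith [sq_nonneg t])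
  have h4 : 0 ≤ ‖u t‖ ^ p.toReal := Real.rpow_nonneg (norm_nonneg _) _
  rw [Real.norm_of_nonneg (by positivity), Pi.add_apply, div_eq_mul_inv]
  rcases le_total ‖u t‖ 1 with h | h
  · nlinarith [norm_nonneg (u t)]
  · have h5 : ‖u t‖ ≤ ‖u t‖ ^ p.toReal := Real.self_le_rpow_of_one_le h h1
    nlinarith [norm_nonneg (u t)]

theorem integrable_norm_div_one_add_sq_of_bounded {u : ℝ → X} (hu : AEStronglyMeasurable u)
    {C : ℝ} (hC : ∀ t, ‖u t‖ ≤ C) : Integrable fun t => ‖u t‖ / (1 + t ^ 2) := by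
  simp_rw [div_eq_mul_inv]
  exact integrable_inv_one_add_sq.bdd_mul hu.norm (ae_of_all _ fun t => by simpa using hC t)

end Weights

namespace C0Semigroup

variable {X : Type*} [NormedAddCommGroup X] [NormedSpace ℂ X] [CompleteSpace X]
  (T : C0Semigroup X)

/-- Mild solutions of moderate growth are unique if the imaginary axis belongs to the resolvent set
of the generator. -/
theorem isMildSolution_unique
    (hA : ∀ s : ℝ, Complex.I * (s : ℂ) ∈ unboundedResolventSet T.generator) {f u v : ℝ → X}
    (hf : LocallyIntegrable f) (hu : T.IsMildSolution f u) (hv : T.IsMildSolution f v)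
    (hu' : Integrable fun t => ‖u t‖ / (1 + t ^ 2))
    (hv' : Integrable fun t => ‖v t‖ / (1 + t ^ 2)) : u = v := by
  have hw : ∀ a b : ℝ, a ≤ b → u b - v b = T.op (b - a) (u a - v a) := fun a b hab =>
    hu.sub_of_same hf hv hab
  have hc : Continuous fun t => u t - v t := T.continuous_of_trajectory (w := fun t => u t - v t) hw
  have hint : Integrable fun t => ‖u t - v t‖ / (1 + t ^ 2) := by
    refine (hu'.add hv').mono' ?_ (ae_of_all _ fun t => ?_)
    · exact (hc.norm.div (by fun_prop) fun t => by positivity).aestronglyMeasurable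
    · rw [Real.norm_of_nonneg (by positivity), Pi.add_apply, ← add_div]
      gcongr
      exact norm_sub_le _ _
  funext t
  exact sub_eq_zero.1 (T.trajectory_eq_zero hA (w := fun t => u t - v t) hw hint t)

/-- Mild solutions are closed under convergence in `L_p` of both data and solutions. -/
theorem exists_isMildSolution_of_tendsto_Lp {p : ℝ≥0∞} [hp : Fact (1 ≤ p)]
    {F u : ℕ → Lp X p (volume : Measure ℝ)} {F' u' : Lp X p (volume : Measure ℝ)}
    (hF : Tendsto F atTop (𝓝 F')) (hu : Tendsto u atTop (𝓝 u')) {v : ℕ → ℝ → X}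
    (hvu : ∀ n, v n =ᵐ[volume] u n) (hv : ∀ n, T.IsMildSolution (F n) (v n)) :
    ∃ v' : ℝ → X, v' =ᵐ[volume] u' ∧ T.IsMildSolution F' v' := by
  -- A subsequence of the solutions converges almost everywhere. The formula passes to the limit at
  -- those times, and the exceptional null set is repaired by propagation.
  obtain ⟨ns, hns, hlim⟩ := (tendstoInMeasure_of_tendsto_Lp hu).exists_seq_tendsto_ae
  have hloc : ∀ G : Lp X p (volume : Measure ℝ), LocallyIntegrable G := fun G =>
    (Lp.memLp G).locallyIntegrable hp.out
  refine T.exists_isMildSolution_of_ae (hloc F')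
    (N := {t | Tendsto (fun i => v (ns i) t) atTop (𝓝 (u' t))}) ?_ ?_
  · filter_upwards [hlim, ae_all_iff.2 hvu] with t ht ht'
    exact ht.congr fun i => (ht' (ns i)).symm
  intro a ha b hb hab
  have hconv : Tendsto (fun n => ∫ s in a..b, T.op (b - s) (F n s)) atTop
      (𝓝 (∫ s in a..b, T.op (b - s) (F' s))) := by
    simp only [intervalIntegral.integral_of_le hab]
    have hi : ∀ G : Lp X p (volume : Measure ℝ),
        Integrable (fun s => T.op (b - s) (G s)) (volume.restrict (Ioc a b)) := fun G =>
      (intervalIntegrable_iff_integrableOn_Ioc_of_le hab).1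
        (T.intervalIntegrable_op (hloc G) hab le_rfl)
    refine tendsto_integral_of_L1' _ (hi F').aestronglyMeasurable
      (Eventually.of_forall fun n => hi (F n)) ?_
    obtain ⟨M, hM0, hM⟩ := T.exists_norm_op_le (b - a)
    have h0 : Tendsto (fun n => eLpNorm (⇑(F n) - ⇑F') p volume) atTop (𝓝 0) :=
      (Lp.tendsto_Lp_iff_tendsto_eLpNorm' F F').1 hF
    -- The Hölder constant `|(a, b]|^{1 - 1/p}` of the embedding of `L_p` into `L_1` on the
    -- interval.
    set c : ℝ≥0∞ := (volume.restrict (Ioc a b)) univ ^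
      (1 / (1 : ℝ≥0∞).toReal - 1 / p.toReal) with hc
    have hctop : c ≠ ∞ := by
      refine ENNReal.rpow_ne_top_of_nonneg ?_ (by simp)
      rw [sub_nonneg, ENNReal.toReal_one, div_one]
      rcases eq_or_ne p ∞ with h | h
      · simp [h]
      · have : 1 ≤ p.toReal := by simpa using ENNReal.toReal_mono h hp.out
        exact div_le_one_of_le₀ this (by linarith)
    have h1 : Tendsto (fun n => ENNReal.ofReal M * (eLpNorm (⇑(F n) - ⇑F') p volume * c)) atTop
        (𝓝 0) := by
      have := ENNReal.Tendsto.const_mul (a := ENNReal.ofReal M)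
        (ENNReal.Tendsto.mul_const (b := c) h0 (Or.inr hctop)) (Or.inr ENNReal.ofReal_ne_top)
      simpa using this
    refine tendsto_of_tendsto_of_tendsto_of_le_of_le tendsto_const_nhds h1 (fun _ => zero_le)
      fun n => ?_
    calc eLpNorm ((fun s => T.op (b - s) (F n s)) - fun s => T.op (b - s) (F' s)) 1
          (volume.restrict (Ioc a b))
        ≤ ENNReal.ofReal M * eLpNorm (⇑(F n) - ⇑F') 1 (volume.restrict (Ioc a b)) := by
          refine eLpNorm_le_mul_eLpNorm_of_ae_le_mul ?_ _
          filter_upwards [ae_restrict_mem measurableSet_Ioc] with s hs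
          rw [Pi.sub_apply, Pi.sub_apply, ← map_sub]
          refine ((T.op _).le_opNorm _).trans ?_
          gcongr
          exact hM _ (by linarith [hs.2]) (by linarith [hs.1])
      _ ≤ ENNReal.ofReal M * (eLpNorm (⇑(F n) - ⇑F') p (volume.restrict (Ioc a b)) * c) := by
          gcongr
          exact eLpNorm_le_eLpNorm_mul_rpow_measure_univ hp.out
            ((Lp.aestronglyMeasurable (F n)).sub (Lp.aestronglyMeasurable F')).restrict
      _ ≤ ENNReal.ofReal M * (eLpNorm (⇑(F n) - ⇑F') p volume * c) := by
          gcongr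
          exact Measure.restrict_le_self
  have h1 := (((T.op (b - a)).continuous.tendsto _).comp ha).add (hconv.comp hns.tendsto_atTop)
  refine tendsto_nhds_unique hb (h1.congr fun i => ?_)
  exact (hv (ns i) a b hab).symm

end C0Semigroup

/-! ### The resolvent as a Fourier multiplier -/

section MultiplierOp

variable {E F : Type*} [NormedAddCommGroup E] [NormedSpace ℂ E] [CompleteSpace E]
  [NormedAddCommGroup F] [NormedSpace ℂ F]

theorem integrable_symbol_fourierHat {m : ℝ → E →L[ℂ] F} (hm : MemLp m ∞) (f : 𝓢(ℝ, E)) :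
    Integrable fun s => m s (fourierHat f s) := by
  have hf := integrable_fourierHat f
  have hmeas : AEStronglyMeasurable (fun s => m s (fourierHat f s)) volume :=
    isBoundedBilinearMap_apply.continuous.comp_aestronglyMeasurable
      (hm.aestronglyMeasurable.prodMk hf.aestronglyMeasurable)
  refine (hf.norm.const_mul (eLpNormEssSup m volume).toReal).mono' hmeas ?_
  have htop : eLpNormEssSup m volume ≠ ∞ := by
    simpa using hm.2.ne
  filter_upwards [ae_le_eLpNormEssSup (f := m) (μ := volume)] with s hs
  refine ((m s).le_opNorm _).trans ?_
  gcongr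
  rw [← toReal_enorm]
  exact ENNReal.toReal_mono htop hs

theorem multiplierOp_sub {m : ℝ → E →L[ℂ] F} (hm : MemLp m ∞) (f g : 𝓢(ℝ, E)) :
    multiplierOp m (f - g : 𝓢(ℝ, E)) = multiplierOp m f - multiplierOp m g := by
  have h1 : ∀ s, fourierHat (f - g : 𝓢(ℝ, E)) s = fourierHat f s - fourierHat g s := by
    intro s
    have hi : ∀ h : 𝓢(ℝ, E), Integrable fun r : ℝ =>
        Complex.exp (-(Complex.I * (r : ℂ) * (s : ℂ))) • h r := by
      intro h
      have := integrable_exp_smul h.integrable (-s)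
      simpa using this
    rw [fourierHat, fourierHat, fourierHat, ← integral_sub (hi f) (hi g)]
    simp [smul_sub]
  funext t
  simp only [multiplierOp, fourierCheck, Pi.sub_apply, h1, map_sub, smul_sub]
  rw [integral_sub (integrable_exp_smul (integrable_symbol_fourierHat hm f) t)
    (integrable_exp_smul (integrable_symbol_fourierHat hm g) t), smul_sub]

/-- The symbol times the transform is integrable, so `multiplierOp m f` is bounded. This admits it
to the uniqueness class before anything is known about its `L_p` norm. -/
theorem integrable_norm_multiplierOp_div {m : ℝ → E →L[ℂ] F} (hm : MemLp m ∞) (f : 𝓢(ℝ, E)) :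
    Integrable fun t => ‖multiplierOp m f t‖ / (1 + t ^ 2) := by
  have hi := integrable_symbol_fourierHat hm f
  refine integrable_norm_div_one_add_sq_of_bounded
    ((continuous_integral_exp_smul hi).const_smul _).aestronglyMeasurable
    (C := ‖(2 * (Real.pi : ℂ))⁻¹‖ * ∫ s, ‖m s (fourierHat f s)‖) fun t => ?_
  rw [multiplierOp, fourierCheck, norm_smul]
  gcongr
  exact norm_integral_exp_smul_le _ t

end MultiplierOp

namespace C0Semigroup

variable {X : Type*} [NormedAddCommGroup X] [NormedSpace ℂ X] [CompleteSpace X]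
  (T : C0Semigroup X) {E : Type*} [NormedAddCommGroup E] [NormedSpace ℂ E] [CompleteSpace E]
  (ι : E →L[ℂ] X)

/-- Superpose the periodic solutions with density `ι` of the transform of `f`; Fourier inversion
identifies the resulting forcing. -/
theorem isMildSolution_multiplierOp
    (hA : ∀ s : ℝ, Complex.I * (s : ℂ) ∈ unboundedResolventSet T.generator)
    (hm : MemLp (fun s : ℝ => (unboundedResolvent T.generator (Complex.I * (s : ℂ))).comp ι) ∞)
    (f : 𝓢(ℝ, E)) :
    T.IsMildSolution (fun s => ι (f s)) (multiplierOp
      (fun s : ℝ => (unboundedResolvent T.generator (Complex.I * (s : ℂ))).comp ι) f) := by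
  have hf := integrable_fourierHat f
  have h1 := (T.isMildSolution_integral_exp hA (ι.integrable_comp hf)
    (integrable_symbol_fourierHat hm f)).const_smul (2 * (Real.pi : ℂ))⁻¹
  convert h1 using 2 with t
  · rw [← fourierCheck_fourierHat f t, fourierCheck, map_smul,
      ← ContinuousLinearMap.integral_comp_comm _ (integrable_exp_smul hf t)]
    simp
  · rfl

/-- If the resolvent is a Fourier multiplier on the imaginary axis, then the inhomogeneous problem
is uniquely solvable in `L_p`. -/
theorem existsUnique_isMildSolution_of_isFourierMultiplier
    (hA : ∀ s : ℝ, Complex.I * (s : ℂ) ∈ unboundedResolventSet T.generator)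
    {p : ℝ≥0∞} (hp : 1 ≤ p) (hp' : p ≠ ∞)
    (hm : IsFourierMultiplier p
      (fun s : ℝ => (unboundedResolvent T.generator (Complex.I * (s : ℂ))).comp ι))
    {g : ℝ → E} (hg : MemLp g p) :
    ∃! u : ℝ → X, MemLp u p ∧ T.IsMildSolution (fun s => ι (g s)) u := by
  have : Fact (1 ≤ p) := ⟨hp⟩
  obtain ⟨hm, C, hC⟩ := hm
  set m : ℝ → E →L[ℂ] X :=
    fun s => (unboundedResolvent T.generator (Complex.I * (s : ℂ))).comp ι with hmdef
  obtain ⟨x, hx, hxg⟩ := mem_closure_iff_seq_limit.1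
    (SchwartzMap.denseRange_toLpCLM (E := ℝ) (F := E) hp' (μ := volume) (hg.toLp g))
  choose f hf using hx
  simp only [SchwartzMap.toLpCLM_apply] at hf
  let u : ℕ → Lp X p (volume : Measure ℝ) := fun n => (hC (f n)).1.toLp _
  -- The multiplier bound for the difference of two Schwartz functions transfers the Cauchy property
  -- from data to solutions.
  have hdist : ∀ n k, dist (u n) (u k) ≤ C * dist (x n) (x k) := by
    intro n k
    rw [← hf n, ← hf k, dist_eq_norm, dist_eq_norm]
    have e1 : u n - u k = (hC (f n - f k)).1.toLp _ := by
      rw [← MemLp.toLp_sub]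
      congr 1
      exact (multiplierOp_sub hm _ _).symm
    have e2 : (f n).toLp p volume - (f k).toLp p volume = (f n - f k).toLp p volume :=
      (MemLp.toLp_sub _ _).symm
    rw [e1, e2, Lp.norm_toLp, SchwartzMap.norm_toLp]
    have := ENNReal.toReal_mono
      (ENNReal.mul_ne_top ENNReal.coe_ne_top ((f n - f k).eLpNorm_lt_top p volume).ne)
      (hC (f n - f k)).2
    rwa [ENNReal.toReal_mul, ENNReal.coe_toReal] at this
  have hcauchy : CauchySeq u := by
    have h1 := cauchySeq_iff_tendsto_dist_atTop_0.1 hxg.cauchySeq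
    refine cauchySeq_iff_tendsto_dist_atTop_0.2 ?_
    have h2 := h1.const_mul (C : ℝ)
    rw [mul_zero] at h2
    exact squeeze_zero (fun _ => dist_nonneg) (fun q => hdist q.1 q.2) h2
  obtain ⟨u', hu'⟩ := cauchySeq_tendsto_of_complete hcauchy
  have hF := ((ι.compLpL p (volume : Measure ℝ)).continuous.tendsto _).comp hxg
  have hcomp : ∀ (h : ℝ → E) (y : Lp E p (volume : Measure ℝ)), y =ᵐ[volume] h →
      (fun s => ι (h s)) =ᵐ[volume] ι.compLpL p (volume : Measure ℝ) y := by
    intro h y hy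
    filter_upwards [hy, ι.coeFn_compLpL (p := p) (μ := volume) y] with s hs hs'
    rw [hs', hs]
  obtain ⟨v, hvu, hv⟩ := T.exists_isMildSolution_of_tendsto_Lp hF hu'
    (v := fun n => multiplierOp m (f n)) (fun n => (MemLp.coeFn_toLp (hC (f n)).1).symm)
    (fun n => (T.isMildSolution_multiplierOp ι hA hm (f n)).congr_ae
      (hcomp _ _ (by rw [← hf n]; exact (f n).coeFn_toLp p)))
  have hv' : T.IsMildSolution (fun s => ι (g s)) v := hv.congr_ae (hcomp _ _ hg.coeFn_toLp).symm
  have hvp : MemLp v p := (Lp.memLp u').ae_eq hvu.symm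
  have hloc : LocallyIntegrable fun s => ι (g s) :=
    (ι.comp_memLp' hg).locallyIntegrable hp
  exact ⟨v, ⟨hvp, hv'⟩, fun w hw => T.isMildSolution_unique hA hloc hw.2 hv'
    (hw.1.integrable_norm_div_one_add_sq hp hp') (hvp.integrable_norm_div_one_add_sq hp hp')⟩

/-- By the closed graph theorem, unique solvability in `L_p` implies an `L_p` estimate. -/
theorem exists_eLpNorm_le_of_existsUnique {p : ℝ≥0∞} (hp : 1 ≤ p)
    (H : ∀ g : ℝ → E, MemLp g p →
      ∃! u : ℝ → X, MemLp u p ∧ T.IsMildSolution (fun s => ι (g s)) u) :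
    ∃ C : ℝ≥0, ∀ (g : ℝ → E) (v : ℝ → X), MemLp g p → MemLp v p →
      T.IsMildSolution (fun s => ι (g s)) v → eLpNorm v p ≤ C * eLpNorm g p := by
  have : Fact (1 ≤ p) := ⟨hp⟩
  have H' : ∀ g : Lp E p (volume : Measure ℝ),
      ∃! u : ℝ → X, MemLp u p ∧ T.IsMildSolution (fun s => ι (g s)) u := fun g => H g (Lp.memLp g)
  choose u hu huniq using H'
  have hloc : ∀ g : Lp E p (volume : Measure ℝ), LocallyIntegrable fun s => ι (g s) := fun g =>
    (ι.comp_memLp' (Lp.memLp g)).locallyIntegrable hp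
  -- Uniqueness makes the solution map linear, with equality at every point and not only almost
  -- everywhere.
  have hadd : ∀ g h, u (g + h) = u g + u h := by
    intro g h
    refine (huniq (g + h) _ ⟨(hu g).1.add (hu h).1, ?_⟩).symm
    refine ((hu g).2.add (hloc g) (hloc h) (hu h).2).congr_ae ?_
    filter_upwards [Lp.coeFn_add g h] with s hs
    rw [hs, Pi.add_apply, map_add]
  have hsmul : ∀ (c : ℂ) g, u (c • g) = c • u g := by
    intro c g
    refine (huniq (c • g) _ ⟨(hu g).1.const_smul c, ?_⟩).symm
    refine ((hu g).2.const_smul c).congr_ae ?_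
    filter_upwards [Lp.coeFn_smul c g] with s hs
    rw [hs, Pi.smul_apply, map_smul]
  let G : Lp E p (volume : Measure ℝ) →ₗ[ℂ] Lp X p (volume : Measure ℝ) :=
    { toFun := fun g => (hu g).1.toLp (u g)
      map_add' := fun g h => by
        rw [← MemLp.toLp_add]
        congr 1
        exact hadd g h
      map_smul' := fun c g => by
        rw [RingHom.id_apply, ← MemLp.toLp_const_smul]
        congr 1
        exact hsmul c g }
  have hGcont : Continuous G := by
    -- If data and solutions both converge, the limit is again a mild solution, and uniqueness
    -- identifies it with the image of the limit.
    refine G.continuous_of_seq_closed_graph fun x g y hx hy => ?_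
    have hcomp : ∀ z : Lp E p (volume : Measure ℝ),
        (fun s => ι (z s)) =ᵐ[volume] ι.compLpL p (volume : Measure ℝ) z := by
      intro z
      filter_upwards [ι.coeFn_compLpL (p := p) (μ := volume) z] with s hs
      rw [hs]
    obtain ⟨v, hvy, hv⟩ := T.exists_isMildSolution_of_tendsto_Lp
      (((ι.compLpL p (volume : Measure ℝ)).continuous.tendsto _).comp hx) hy
      (v := fun n => u (x n)) (fun n => (MemLp.coeFn_toLp (hu (x n)).1).symm)
      (fun n => (hu (x n)).2.congr_ae (hcomp _))
    have h1 : v = u g := huniq g v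
      ⟨(Lp.memLp y).ae_eq hvy.symm, hv.congr_ae (hcomp g).symm⟩
    refine Lp.ext ?_
    rw [h1] at hvy
    exact hvy.symm.trans (MemLp.coeFn_toLp (hu g).1).symm
  let G' : Lp E p (volume : Measure ℝ) →L[ℂ] Lp X p (volume : Measure ℝ) := ⟨G, hGcont⟩
  refine ⟨‖G'‖₊, fun g v hg hv hmild => ?_⟩
  have h1 : v = u (hg.toLp g) := by
    refine huniq _ v ⟨hv, hmild.congr_ae ?_⟩
    filter_upwards [hg.coeFn_toLp] with s hs
    rw [hs]
  have h2 := G'.le_opNorm (hg.toLp g)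
  have h3 : G' (hg.toLp g) = hv.toLp v := by
    subst h1
    rfl
  rw [h3, Lp.norm_toLp, Lp.norm_toLp] at h2
  rw [← ENNReal.ofReal_toReal hv.2.ne, ← ENNReal.ofReal_toReal hg.2.ne]
  refine (ENNReal.ofReal_le_ofReal h2).trans ?_
  rw [ENNReal.ofReal_mul (norm_nonneg _), ofReal_norm, enorm_eq_nnnorm]

/-- An `L_p` estimate for mild solutions implies uniform boundedness of the resolvent on the
imaginary axis. -/
theorem norm_resolvent_comp_le_of_eLpNorm_le {p : ℝ≥0∞} (hp : 1 ≤ p) (hp' : p ≠ ∞) {C : ℝ≥0}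
    (hC : ∀ (g : ℝ → E) (v : ℝ → X), MemLp g p → MemLp v p →
      T.IsMildSolution (fun s => ι (g s)) v → eLpNorm v p ≤ C * eLpNorm g p)
    {s : ℝ} (hs : Complex.I * (s : ℂ) ∈ unboundedResolventSet T.generator)
    (hι : ∀ x : E, ∃ y : E, ι y = unboundedResolvent T.generator (Complex.I * (s : ℂ)) (ι x)) :
    ‖(unboundedResolvent T.generator (Complex.I * (s : ℂ))).comp ι‖ ≤ C := by
  have hp0 : p ≠ 0 := (zero_lt_one.trans_le hp).ne'
  refine ContinuousLinearMap.opNorm_le_bound _ C.coe_nonneg fun x => ?_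
  obtain ⟨y, hy⟩ := hι x
  set z : X := unboundedResolvent T.generator (Complex.I * (s : ℂ)) (ι x) with hz
  change ‖z‖ ≤ C * ‖x‖
  suffices h : ∀ ε : ℝ, 0 < ε → ‖z‖ ≤ C * (‖x‖ + ε * ‖y‖) by
    have hlim : Tendsto (fun ε : ℝ => (C : ℝ) * (‖x‖ + ε * ‖y‖)) (𝓝[>] 0) (𝓝 (C * ‖x‖)) := by
      have hc : Continuous fun ε : ℝ => (C : ℝ) * (‖x‖ + ε * ‖y‖) := by fun_prop
      simpa using (hc.tendsto 0).mono_left (nhdsWithin_le_nhds (s := Ioi 0))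
    exact ge_of_tendsto hlim (by filter_upwards [self_mem_nhdsWithin] with ε hε using h ε hε)
  intro ε hε
  -- The periodic solution is not in `L_p`, so it is multiplied by a cutoff that varies slowly at
  -- scale `1/ε`.
  let φ : ℝ → ℝ := fun t => (1 + (ε * t) ^ 2)⁻¹
  let φ' : ℝ → ℝ := fun t => -(2 * ε ^ 2 * t) / (1 + (ε * t) ^ 2) ^ 2
  let e : ℝ → ℂ := fun t => Complex.exp (Complex.I * (s : ℂ) * (t : ℂ))
  have hφpos : ∀ t, 0 < φ t := fun t => by positivity
  have hφc : Continuous φ := Continuous.inv₀ (by fun_prop) fun t => by positivity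
  have hφ'c : Continuous φ' := Continuous.div (by fun_prop) (by fun_prop) fun t => by positivity
  have hφ' : ∀ t, |φ' t| ≤ ε * φ t := abs_deriv_inv_one_add_mul_sq_le hε.le
  have hφp : MemLp φ p := memLp_inv_one_add_mul_sq hε.ne' hp hp'
  have hφ0 : eLpNorm φ p ≠ 0 := by
    rw [Ne, eLpNorm_eq_zero_iff hφc.aestronglyMeasurable hp0,
      hφc.ae_eq_iff_eq volume continuous_zero]
    intro h
    exact (hφpos 0).ne' (congrFun h 0)
  have hec : Continuous e :=
    continuous_exp_I_mul_mul.comp (continuous_const.prodMk continuous_id)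
  have he : ∀ t, HasDerivAt e (e t * (Complex.I * (s : ℂ))) t := by
    intro t
    have h1 : HasDerivAt (fun t : ℝ => Complex.I * (s : ℂ) * (t : ℂ)) (Complex.I * (s : ℂ)) t := by
      simpa using (Complex.ofRealCLM.hasDerivAt (x := t)).const_mul (Complex.I * (s : ℂ))
    exact h1.cexp
  have hen : ∀ t, ‖e t‖ = 1 := fun t => norm_exp_I_mul_mul s t
  have hφC : Continuous fun t => (φ t : ℂ) := Complex.continuous_ofReal.comp hφc
  have hφ'C : Continuous fun t => (φ' t : ℂ) := Complex.continuous_ofReal.comp hφ'c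
  -- Differentiating the cutoff adds the term `φ' e z` to the forcing. It is `E`-valued because `z =
  -- ι y`, and it costs only `ε ‖y‖` relative to `φ`.
  let g : ℝ → E := fun t => ((φ t : ℂ) * e t) • x + ((φ' t : ℂ) * e t) • y
  have hgc : Continuous g :=
    ((hφC.mul hec).smul continuous_const).add ((hφ'C.mul hec).smul continuous_const)
  have hmild : T.IsMildSolution (fun t => ι (g t)) (fun t => ((φ t : ℂ) * e t) • z) := by
    have h1 : T.IsMildSolution
        (fun t => ((φ' t : ℂ) * e t + (φ t : ℂ) * (e t * (Complex.I * (s : ℂ)))) • z -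
          ((φ t : ℂ) * e t) • ((Complex.I * (s : ℂ)) • z - ι x))
        (fun t => ((φ t : ℂ) * e t) • z) := (T.hasGenerator_resolvent hs (ι x)).isMildSolution_smul
      (c := fun t => (φ t : ℂ) * e t)
      (fun t => ((hasDerivAt_inv_one_add_mul_sq ε t).ofReal_comp).mul (he t))
      ((hφ'C.mul hec).add (hφC.mul (hec.mul continuous_const)))
    convert h1 using 2 with t
    simp only [g, map_add, map_smul, hy]
    module
  have hgn : ∀ t, ‖g t‖ ≤ (‖x‖ + ε * ‖y‖) * ‖φ t‖ := by
    intro t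
    refine (norm_add_le _ _).trans ?_
    rw [norm_smul, norm_smul, norm_mul, norm_mul, hen, mul_one, mul_one, Complex.norm_real,
      Complex.norm_real, Real.norm_of_nonneg (hφpos t).le]
    have := mul_le_mul_of_nonneg_right (hφ' t) (norm_nonneg y)
    rw [← Real.norm_eq_abs] at this
    nlinarith
  have hvn : ∀ t, ‖((φ t : ℂ) * e t) • z‖ = ‖z‖ * ‖φ t‖ := by
    intro t
    rw [norm_smul, norm_mul, hen, mul_one, Complex.norm_real, mul_comm]
  have hgp : MemLp g p := hφp.of_le_mul hgc.aestronglyMeasurable (ae_of_all _ hgn)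
  have hvp : MemLp (fun t => ((φ t : ℂ) * e t) • z) p :=
    hφp.of_le_mul ((hφC.mul hec).smul continuous_const).aestronglyMeasurable
      (ae_of_all _ fun t => (hvn t).le)
  have hB : 0 ≤ ‖x‖ + ε * ‖y‖ := by positivity
  have hmain := hC g (fun t => ((φ t : ℂ) * e t) • z) hgp hvp hmild
  clear_value g φ φ' e z
  have h1 : ENNReal.ofReal ‖z‖ * eLpNorm φ p (volume : Measure ℝ) ≤
      C * (ENNReal.ofReal (‖x‖ + ε * ‖y‖) * eLpNorm φ p (volume : Measure ℝ)) := by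
    calc ENNReal.ofReal ‖z‖ * eLpNorm φ p (volume : Measure ℝ) = eLpNorm (fun t => ((φ t : ℂ) * e t) • z) p (volume : Measure ℝ) := by
          rw [ofReal_norm, ← enorm_norm z, ← eLpNorm_const_smul]
          refine eLpNorm_congr_norm_ae (ae_of_all _ fun t => ?_)
          rw [hvn, Pi.smul_apply, norm_smul, norm_norm]
      _ ≤ C * eLpNorm g p (volume : Measure ℝ) := hmain
      _ ≤ C * (ENNReal.ofReal (‖x‖ + ε * ‖y‖) * eLpNorm φ p (volume : Measure ℝ)) := mul_le_mul_right
          (eLpNorm_le_mul_eLpNorm_of_ae_le_mul (f := g) (g := φ) (ae_of_all _ hgn) p) _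
  rw [← mul_assoc] at h1
  -- The common factor `eLpNorm φ p` is finite and nonzero, so it cancels and leaves a pointwise
  -- bound for the resolvent.
  have h2 := (ENNReal.mul_le_mul_iff_left hφ0 hφp.2.ne).1 h1
  rw [← ENNReal.ofReal_coe_nnreal, ← ENNReal.ofReal_mul C.coe_nonneg] at h2
  exact (ENNReal.ofReal_le_ofReal_iff (mul_nonneg C.coe_nonneg hB)).1 h2

/-- Unique solvability of the inhomogeneous problem in `L_p` implies that the resolvent is a Fourier
multiplier on the imaginary axis. -/
theorem isFourierMultiplier_of_existsUnique_isMildSolution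
    (hA : ∀ s : ℝ, Complex.I * (s : ℂ) ∈ unboundedResolventSet T.generator)
    (hι : ∀ (s : ℝ) (x : E), ∃ y : E,
      ι y = unboundedResolvent T.generator (Complex.I * (s : ℂ)) (ι x))
    {p : ℝ≥0∞} (hp : 1 ≤ p) (hp' : p ≠ ∞)
    (H : ∀ g : ℝ → E, MemLp g p →
      ∃! u : ℝ → X, MemLp u p ∧ T.IsMildSolution (fun s => ι (g s)) u) :
    IsFourierMultiplier p
      (fun s : ℝ => (unboundedResolvent T.generator (Complex.I * (s : ℂ))).comp ι) := by
  obtain ⟨C, hC⟩ := T.exists_eLpNorm_le_of_existsUnique ι hp H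
  have hmc : Continuous fun s : ℝ =>
      (unboundedResolvent T.generator (Complex.I * (s : ℂ))).comp ι :=
    (contDiff_resolvent_I_mul hA).continuous.clm_comp continuous_const
  have hm : MemLp (fun s : ℝ =>
      (unboundedResolvent T.generator (Complex.I * (s : ℂ))).comp ι) ∞ :=
    memLp_top_of_bound hmc.aestronglyMeasurable C (ae_of_all _ fun s =>
      T.norm_resolvent_comp_le_of_eLpNorm_le ι hp hp' hC (hA s) (hι s))
  refine ⟨hm, C, fun f => ?_⟩
  have hfp : MemLp f p := f.memLp p
  obtain ⟨u, ⟨hup, hu⟩, -⟩ := H f hfp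
  have hMf := T.isMildSolution_multiplierOp ι hA hm f
  -- The `L_p` solution and the bounded function `multiplierOp` of `f` solve the same problem within
  -- the uniqueness class.
  have heq := T.isMildSolution_unique hA ((ι.comp_memLp' hfp).locallyIntegrable hp) hu hMf
    (hup.integrable_norm_div_one_add_sq hp hp') (integrable_norm_multiplierOp_div hm f)
  rw [← heq]
  exact ⟨hup, hC f u hfp hup hu⟩

end C0Semigroup

/-! ### Fractional powers commute with the resolvent -/

section FracPow

variable {X : Type*} [NormedAddCommGroup X] [NormedSpace ℂ X]

/-- A non-integrable `F` has Bochner integral `0`, which also commutes with `S`, so convergence need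
not be checked. -/
theorem commute_integral {α : Type*} [MeasurableSpace α] {μ : Measure α} {S : X →L[ℂ] X}
    {F : α → X →L[ℂ] X} (h : ∀ t, Commute S (F t)) : Commute S (∫ t, F t ∂μ) := by
  by_cases hF : Integrable F μ
  · rw [commute_iff_eq, ← integral_const_mul_of_integrable hF, ← integral_mul_const_of_integrable hF]
    exact integral_congr_ae (ae_of_all _ fun t => (h t).eq)
  · rw [integral_undef hF]
    exact Commute.zero_right S

theorem commute_wedgeIntegral {S : X →L[ℂ] X} {F : ℂ → X →L[ℂ] X} (θ : ℝ)
    (h : ∀ μ, Commute S (F μ)) : Commute S (wedgeIntegral θ F) :=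
  (commute_integral fun _ => (h _).smul_right _).sub_right
    (commute_integral fun _ => (h _).smul_right _)

theorem C0Semigroup.commute_resolvent_fracPowNeg (T : C0Semigroup X) (z : ℂ) (ω θ α : ℝ) :
    Commute (unboundedResolvent T.generator z) (T.fracPowNeg ω θ α) := by
  rw [C0Semigroup.fracPowNeg]
  split_ifs with h
  · exact Commute.one_right _
  · exact (commute_wedgeIntegral θ fun μ =>
      (commute_unboundedResolvent _ _).smul_right _).smul_right _

end FracPow

theorem theorem3p8 {X : Type*} [NormedAddCommGroup X] [NormedSpace ℂ X] [CompleteSpace X]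
    (T : C0Semigroup X) (ω θ α : ℝ) (hω : max (T.growthBound + 3) 3 < (ω : EReal))
    (hθ : 0 < θ) (hθ' : θ < Real.pi / 6) (hα : 0 ≤ α)
    (p : ℝ≥0∞) (hp : 1 ≤ p) (hp' : p ≠ ∞)
    (hA : ∀ s : ℝ, Complex.I * (s : ℂ) ∈ unboundedResolventSet T.generator) :
    IsFourierMultiplier p
        (fun s : ℝ => (unboundedResolvent T.generator (Complex.I * (s : ℂ))).comp
          (T.fracIncl ω θ α)) ↔
      ∀ g : ℝ → T.FracDomain ω θ α, MemLp g p (volume : Measure ℝ) →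
        ∃! u : ℝ → X, MemLp u p (volume : Measure ℝ) ∧
          T.IsMildSolution (fun s => T.fracIncl ω θ α (g s)) u := by
  refine ⟨fun hm g hg =>
    T.existsUnique_isMildSolution_of_isFourierMultiplier _ hA hp hp' hm hg,
    T.isFourierMultiplier_of_existsUnique_isMildSolution _ hA (fun s x => ?_) hp hp'⟩
  -- Writing `x = J y` with `J` the negative fractional power, `R(is) J y = J R(is) y` lies again in
  -- the range of `J`.
  obtain ⟨y, hy⟩ := x.2
  refine ⟨OpRange.mk _ (unboundedResolvent T.generator (Complex.I * (s : ℂ)) y), ?_⟩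
  have h := DFunLike.congr_fun
    (T.commute_resolvent_fracPowNeg (Complex.I * (s : ℂ)) ω θ α).eq y
  exact h.symm.trans (congrArg _ hy)
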